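/- Let $k,p\ge 0$ be integers and put $n=2k+1$, $\beta=(k+1,\dots,k+1)\in\mathbb N_0^p$. Let $\Omega=\prod_{i=1}^p[a_i,b_i]\subset\mathbb R^p$ be a closed rectangle with a rectangular grid: for each $i$, nodes $a_i=t_{i,0}<t_{i,1}<\dots<t_{i,N_i}=b_i$, $N_i\ge 1$ (not necessarily equidistant). The grid points are $x_m=(t_{1,m_1},\dots,t_{p,m_p})$, and the cells are the products $Q=\prod_i[t_{i,c_i},t_{i,c_i+1}]$, with interiors $Q^\circ$. Partial derivatives at points of $\partial\Omega$ are one-sided where necessary. *Interpolant.* Given data $d=(d_{m,\alpha})$, $\alpha\in\{0,\dots,k\}^p$, let $\mathcal H_d:\Omega\to\mathbb R$ be the function which on each cell $Q$ is the polynomial of degree $\le n$ in each variable given by $$\sum_{q\in\{0,1\}^p}\ \sum_{\alpha\in\{0,\dots,k\}^p} d_{c+q,\alpha}\prod_{i=1}^p(\Delta x_i)^{\alpha_i}\,w^{q_i}_{\alpha_i}(\xi_i),\qquad \Delta x_i=t_{i,c_i+1}-t_{i,c_i},\quad \xi_i=\frac{x_i-t_{i,c_i}}{\Delta x_i},$$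 where $w^{q}_{a}$ ($q\in\{0,1\}$, $0\le a\le k$) is the univariate polynomial of degree $\le n$ with $\frac{d^{a'}}{dx^{a'}}w^q_a(q')=\delta_{aa'}\delta_{qq'}$ for $q'\in\{0,1\}$, $0\le a'\le k$. For a function $\varphi:\Omega\to\mathbb R$ put $\mathcal H_\varphi=\mathcal H_d$ with $d_{m,\alpha}=\partial^\alpha\varphi(x_m)$. *Admissible functions.* For $r\in\mathbb N_0\cup\{\infty\}$, say that $\psi:\Omega\to\mathbb R$ is cellwise $C^r$ if it is $C^r$ in $Q^\circ$ for every cell $Q$, and that $\psi$ matches the data $d$ if for every cell $Q$, every vertex $x_m$ of $Q$ and every $\alpha\in\{0,\dots,k\}^p$ one has $\partial^\alpha\psi(x)\to d_{m,\alpha}$ as $x\to x_m$ in $Q^\circ$. *Stability functional.* $\mathcal F[\psi]=\int_\Omega(\partial^\beta\psi)^2\,dx\in[0,\infty]$. **Theorem.** Let $\varphi:\Omega\to\mathbb R$ be cellwise $C^{p(k+1)}$ and match its own grid data $d_{m,\alpha}=\partial^\alpha\varphi(x_m)$ (this holds, for example, for every $\varphi\in C^{p(k+1)}(\Omega)$).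 Then: 1. $\mathcal H_\varphi$ is cellwise $C^\infty$, matches the data $d$, satisfies $\partial^\alpha\mathcal H_\varphi(x_m)=\partial^\alpha\varphi(x_m)$ for all grid points $x_m$ and all $\alpha\in\{0,\dots,k\}^p$, and $\mathcal F[\mathcal H_\varphi]<\infty$. 2. $\mathcal F[\mathcal H_\varphi]\le\mathcal F[\varphi]$. 3. $\mathcal H_\varphi$ minimizes $\mathcal F$ among the cellwise smooth functions with the same data: $\mathcal F[\mathcal H_\varphi]\le\mathcal F[\psi]$ for every cellwise $C^{p(k+1)}$ function $\psi$ that matches the data $d$. 4. For every cell $Q$ on which $\partial^\beta\varphi$ is integrable, the function $\partial^\beta\mathcal H_\varphi\cdot\partial^\beta(\varphi-\mathcal H_\varphi)$ is integrable on $Q$ and $$\int_Q\partial^\beta\mathcal H_\varphi\;\partial^\beta(\varphi-\mathcal H_\varphi)\,dx=0 .$$ -/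

import Mathlib

open scoped Topology ContDiff Polynomial

noncomputable section

/-- A rectangular (tensor product) grid in `ℝ^p`: along the `i`-th axis there are `numCells i ≥ 1`
cells, cut out by the nodes `node i 0 < node i 1 < ⋯ < node i (numCells i)`.
The spacing may be uniform or not. -/
structure RectGrid (p : ℕ) where
  /-- number of cells along each axis -/
  numCells : Fin p → ℕ
  numCells_pos : ∀ i, 0 < numCells i
  /-- the coordinates of the grid hyperplanes perpendicular to each axis -/
  node : ∀ i, Fin (numCells i + 1) → ℝ
  node_strictMono : ∀ i, StrictMono (node i)

namespace RectGrid

variable {p : ℕ} (G : RectGrid p)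

/-- Labels `m` of grid points. -/
abbrev Index : Type := ∀ i, Fin (G.numCells i + 1)

/-- Labels `c` of grid cells (the label of the vertex with the lowest components). -/
abbrev Cell : Type := ∀ i, Fin (G.numCells i)

/-- The grid point `x_m`. -/
def point (m : G.Index) : Fin p → ℝ := fun i => G.node i (m i)

/-- The lower corner of the domain. -/
def lo : Fin p → ℝ := fun i => G.node i 0

/-- The upper corner of the domain. -/
def hi : Fin p → ℝ := fun i => G.node i (Fin.last _)

/-- The computational domain `Ω`, a closed `p`-rectangle. -/
def domain : Set (Fin p → ℝ) := Set.univ.pi fun i => Set.Icc (G.lo i) (G.hi i)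

/-- The label `c + q` of the vertex with index `q ∈ {0,1}^p` of the cell `c`. -/
def vertex (c : G.Cell) (q : Fin p → Fin 2) : G.Index :=
  fun i => ⟨(c i : ℕ) + (q i : ℕ), by have := (c i).isLt; have := (q i).isLt; omega⟩

/-- Lower corner of the cell `c`. -/
def cellLo (c : G.Cell) : Fin p → ℝ := fun i => G.node i (c i).castSucc

/-- Upper corner of the cell `c`. -/
def cellHi (c : G.Cell) : Fin p → ℝ := fun i => G.node i (c i).succ

/-- The closed cell `Q`. -/
def closedCell (c : G.Cell) : Set (Fin p → ℝ) :=
  Set.univ.pi fun i => Set.Icc (G.cellLo c i) (G.cellHi c i)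

/-- The interior of the cell. -/
def openCell (c : G.Cell) : Set (Fin p → ℝ) :=
  Set.univ.pi fun i => Set.Ioo (G.cellLo c i) (G.cellHi c i)

/-- The partial derivative `∂_i f` of a function on `Ω` (at a point of `∂Ω` where the line in the
direction `x_i` leaves `Ω` it is the one-sided derivative). -/
def pderiv (i : Fin p) (f : (Fin p → ℝ) → ℝ) : (Fin p → ℝ) → ℝ := fun x =>
  derivWithin (fun s => f (Function.update x i s)) (Set.Icc (G.lo i) (G.hi i)) (x i)

/-- The mixed partial derivative `∂^α f = ∂_1^{α_1} ⋯ ∂_p^{α_p} f` of a function on `Ω`. -/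
def mixedDeriv (α : Fin p → ℕ) (f : (Fin p → ℝ) → ℝ) : (Fin p → ℝ) → ℝ :=
  (List.finRange p).foldr (fun i g => (G.pderiv i)^[α i] g) f

/-- Grid data: a number for every grid point and every `α ∈ {0,…,k}^p`. -/
abbrev Data (k : ℕ) : Type := G.Index → (Fin p → Fin (k + 1)) → ℝ

/-- The data `∂^α φ(x_m)`, `α ∈ {0,…,k}^p`, of a function `φ`. -/
def gridData (k : ℕ) (φ : (Fin p → ℝ) → ℝ) : G.Data k := fun m α =>
  G.mixedDeriv (fun i => (α i : ℕ)) φ (G.point m)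

/-- `ψ` is of class `C^r` inside every grid cell. -/
def CellwiseSmooth (r : WithTop ℕ∞) (ψ : (Fin p → ℝ) → ℝ) : Prop :=
  ∀ c : G.Cell, ContDiffOn ℝ r ψ (G.openCell c)

/-- `ψ` has the grid data `d`, seen from inside each cell: at every vertex of every cell, and for
every `α ∈ {0,…,k}^p`, the limit of `∂^α ψ` from inside of that cell is the prescribed number. -/
def MatchesData (k : ℕ) (d : G.Data k) (ψ : (Fin p → ℝ) → ℝ) : Prop :=
  ∀ (c : G.Cell) (q : Fin p → Fin 2) (α : Fin p → Fin (k + 1)),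
    Filter.Tendsto (G.mixedDeriv (fun i => (α i : ℕ)) ψ)
      (𝓝[G.openCell c] G.point (G.vertex c q)) (𝓝 (d (G.vertex c q) α))

/-- The univariate Hermite basis polynomial `w_{n,a}^q` with `n = 2k+1`: of degree at most `n`, its
derivative of order `a` at `q` is `1`, and all its other derivatives of order `≤ k` at the points
`0`, `1` vanish (`hermiteBasis_natDegree_le` and `hermiteBasis_eval`). -/
def hermiteBasis (k a : ℕ) (q : Fin 2) : ℝ[X] :=
  let w : ℝ[X] := Polynomial.C ((a.factorial : ℝ)⁻¹) * Polynomial.X ^ a *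
    (1 - Polynomial.X) ^ (k + 1) *
    ∑ j ∈ Finset.range (k + 1 - a), Polynomial.C (((k + j).choose k : ℕ) : ℝ) * Polynomial.X ^ j
  if q = 0 then w else (-1) ^ a * w.comp (1 - Polynomial.X)

/-- The part of `hermiteBasis` at `q = 0`. -/
theorem hermiteBasis_zero_coeff (k a b : ℕ) (ha : a ≤ k) (hb : b ≤ k) :
    (hermiteBasis k a 0).coeff b = if a = b then (a.factorial : ℝ)⁻¹ else 0 := by
  have key : ∀ m ≤ k - a, ((1 - Polynomial.X : ℝ[X]) ^ (k + 1) * ∑ j ∈ Finset.range (k + 1 - a),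
      Polynomial.C (((k + j).choose k : ℕ) : ℝ) * Polynomial.X ^ j).coeff m
      = if m = 0 then 1 else 0 := by
    intro m hm
    have h1 : ((PowerSeries.mk fun n => (Nat.choose (k + n) k : ℝ)) *
        (1 - PowerSeries.X) ^ (k + 1)) = 1 :=
      (PowerSeries.invOneSubPow_val_succ_eq_mk_add_choose ℝ k) ▸
        (PowerSeries.invOneSubPow ℝ (k + 1)).val_inv
    have h2 := congrArg (PowerSeries.coeff m) h1
    rw [mul_comm, PowerSeries.coeff_mul, PowerSeries.coeff_one] at h2
    rw [Polynomial.coeff_mul, ← h2]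
    refine Finset.sum_congr rfl fun x hx => ?_
    have hx' := Finset.HasAntidiagonal.mem_antidiagonal.1 hx
    congr 1
    · rw [← Polynomial.coeff_coe]; simp
    · simp only [Polynomial.finsetSum_coeff, Polynomial.coeff_C_mul_X_pow, PowerSeries.coeff_mk]
      rw [Finset.sum_eq_single x.2]
      · simp
      · intro j _ hj; simp [Ne.symm hj]
      · intro h; exact absurd (Finset.mem_range.2 (by omega)) h
  simp only [hermiteBasis, if_true, mul_assoc, Polynomial.coeff_C_mul]
  rw [Polynomial.coeff_X_pow_mul']
  rcases lt_trichotomy a b with h | h | h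
  · rw [if_pos h.le, key _ (by omega), if_neg (by omega), if_neg h.ne]; simp
  · subst h; rw [if_pos le_rfl, key _ (by omega)]; simp
  · rw [if_neg (by omega), if_neg (by omega)]; simp

theorem hermiteBasis_eval (k a b : ℕ) (q r : Fin 2) (ha : a ≤ k) (hb : b ≤ k) :
    (Polynomial.derivative^[b] (hermiteBasis k a q)).eval ((r : ℕ) : ℝ) =
      if a = b ∧ q = r then 1 else 0 := by
  have hflip : hermiteBasis k a 1 = (-1) ^ a * (hermiteBasis k a 0).comp (1 - Polynomial.X) := by
    simp [hermiteBasis]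
  have h0 : (Polynomial.derivative^[b] (hermiteBasis k a 0)).eval 0 = if a = b then 1 else 0 := by
    rw [← Polynomial.coeff_zero_eq_eval_zero, Polynomial.coeff_iterate_derivative, zero_add,
      hermiteBasis_zero_coeff k a b ha hb, Nat.descFactorial_self]
    split_ifs with h
    · subst h; simp [Nat.factorial_ne_zero]
    · simp
  have h1 : (Polynomial.derivative^[b] (hermiteBasis k a 0)).eval 1 = 0 := by
    have hc : ((hermiteBasis k a 0).comp (1 - Polynomial.X)).coeff b = 0 := by
      have : (hermiteBasis k a 0).comp (1 - Polynomial.X) = Polynomial.X ^ (k + 1) *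
          ((Polynomial.C ((a.factorial : ℝ)⁻¹) * Polynomial.X ^ a *
          ∑ j ∈ Finset.range (k + 1 - a), Polynomial.C (((k + j).choose k : ℕ) : ℝ) *
            Polynomial.X ^ j).comp (1 - Polynomial.X)) := by
        simp only [hermiteBasis, if_true, Polynomial.mul_comp, Polynomial.pow_comp,
          Polynomial.sub_comp, Polynomial.one_comp, Polynomial.X_comp, sub_sub_cancel]
        ring
      rw [this, Polynomial.coeff_X_pow_mul', if_neg (by omega)]
    have hd : (Polynomial.derivative^[b] ((hermiteBasis k a 0).comp (1 - Polynomial.X))).eval 0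
        = 0 := by
      rw [← Polynomial.coeff_zero_eq_eval_zero, Polynomial.coeff_iterate_derivative, zero_add, hc]
      simp
    rw [Polynomial.iterate_derivative_comp_one_sub_X] at hd
    simpa [Polynomial.eval_mul, Polynomial.eval_comp] using hd
  have hder : Polynomial.derivative^[b] (hermiteBasis k a 1) = Polynomial.C ((-1) ^ a) *
      ((-1) ^ b * (Polynomial.derivative^[b] (hermiteBasis k a 0)).comp (1 - Polynomial.X)) := by
    rw [hflip, ← Polynomial.iterate_derivative_comp_one_sub_X,
      ← Polynomial.iterate_derivative_C_mul]
    simp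
  fin_cases q <;> fin_cases r
  · simpa using h0
  · simpa using h1
  · simp [hder, Polynomial.eval_comp, h1]
  · simp only [Fin.mk_one, hder, Polynomial.eval_mul, Polynomial.eval_comp]
    simp [h0]
    split_ifs with h
    · subst h; rw [← mul_pow]; simp
    · rfl

theorem hermiteBasis_natDegree_le (k a : ℕ) (q : Fin 2) (ha : a ≤ k) :
    (hermiteBasis k a q).natDegree ≤ 2 * k + 1 := by
  have h1 : (1 - Polynomial.X : ℝ[X]).natDegree ≤ 1 := by compute_degree
  have h0 : (hermiteBasis k a 0).natDegree ≤ 2 * k + 1 := by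
    have hs : (∑ j ∈ Finset.range (k + 1 - a), Polynomial.C (((k + j).choose k : ℕ) : ℝ) *
        Polynomial.X ^ j).natDegree ≤ k - a :=
      Polynomial.natDegree_sum_le_of_forall_le _ _ fun j hj =>
        (Polynomial.natDegree_C_mul_X_pow_le _ _).trans (by have := Finset.mem_range.1 hj; omega)
    have hp : ((1 - Polynomial.X : ℝ[X]) ^ (k + 1)).natDegree ≤ k + 1 :=
      (Polynomial.natDegree_pow_le_of_le _ h1).trans (by omega)
    simp only [hermiteBasis, if_true]
    refine (Polynomial.natDegree_mul_le_of_le (Polynomial.natDegree_mul_le_of_le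
      (Polynomial.natDegree_C_mul_X_pow_le _ a) hp) hs).trans (by omega)
  fin_cases q
  · exact h0
  · have hflip : hermiteBasis k a 1 =
        Polynomial.C ((-1) ^ a) * (hermiteBasis k a 0).comp (1 - Polynomial.X) := by
      simp [hermiteBasis]
    simp only [Fin.mk_one, hflip]
    refine (Polynomial.natDegree_C_mul_le _ _).trans (Polynomial.natDegree_comp_le.trans ?_)
    nlinarith

/-- The `p`-`n` polynomial (`n = 2k+1`) that interpolates the data `d` at the vertices of the
cell `c`, as a sum of tensor products of univariate basis polynomials in the relative coordinates
`ξ_i = (x_i - a_i) / Δx_i`. -/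
def cellInterpolant (k : ℕ) (d : G.Data k) (c : G.Cell) (x : Fin p → ℝ) : ℝ :=
  ∑ q : Fin p → Fin 2, ∑ α : Fin p → Fin (k + 1), d (G.vertex c q) α *
    ∏ i, (G.cellHi c i - G.cellLo c i) ^ (α i : ℕ) *
      (hermiteBasis k (α i) (q i)).eval
        ((x i - G.cellLo c i) / (G.cellHi c i - G.cellLo c i))

open Classical in
/-- The global interpolant of the data `d`: in every cell it is the `p`-`n` polynomial that
interpolates the data at the vertices of this cell. (At a point on the common boundary of several
cells the polynomials of these cells have the same value, so it does not matter which is taken.) -/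
def interpolant (k : ℕ) (d : G.Data k) (x : Fin p → ℝ) : ℝ :=
  if h : ∃ c : G.Cell, x ∈ G.closedCell c then G.cellInterpolant k d h.choose x else 0

/-- The global interpolant `H_φ` of a function `φ`. -/
def hermite (k : ℕ) (φ : (Fin p → ℝ) → ℝ) : (Fin p → ℝ) → ℝ :=
  G.interpolant k (G.gridData k φ)

/-- The multi-index `β = (k+1,…,k+1)`. -/
def beta (p k : ℕ) : Fin p → ℕ := fun _ => k + 1

/-- The stability functional `F[φ] = ∫_Ω (∂^β φ)^2`, with values in `[0,∞]`. -/
def stability (k : ℕ) (φ : (Fin p → ℝ) → ℝ) : ENNReal :=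
  ∫⁻ x in G.domain, ENNReal.ofReal ((G.mixedDeriv (beta p k) φ x) ^ 2)

theorem contDiffOn_pderiv (i : Fin p) (f : (Fin p → ℝ) → ℝ) (n : ℕ)
    (hf : ContDiffOn ℝ ((n + 1 : ℕ) : WithTop ℕ∞) f G.domain) :
    ContDiffOn ℝ (n : WithTop ℕ∞) (G.pderiv i f) G.domain := by
  have hlt : ∀ j, G.lo j < G.hi j := fun j => G.node_strictMono j (by
    rw [Fin.lt_def]; exact G.numCells_pos j)
  have hu : UniqueDiffOn ℝ G.domain :=
    UniqueDiffOn.univ_pi fun j => uniqueDiffOn_Icc (hlt j)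
  have h1 : ContDiffOn ℝ (n : WithTop ℕ∞)
      (fun x => fderivWithin ℝ f G.domain x (Pi.single i 1)) G.domain :=
    (hf.fderivWithin hu (m := (n : WithTop ℕ∞)) (by exact_mod_cast le_rfl)).clm_apply
      contDiffOn_const
  refine h1.congr fun x hx => ?_
  have hxi : x i ∈ Set.Icc (G.lo i) (G.hi i) := hx i (Set.mem_univ i)
  have hd : HasFDerivWithinAt f (fderivWithin ℝ f G.domain x) G.domain
      (Function.update x i (x i)) := by
    rw [Function.update_eq_self]
    exact (hf.differentiableOn (by exact_mod_cast Nat.succ_ne_zero n) x hx).hasFDerivWithinAt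
  have hup : HasDerivWithinAt (Function.update x i) (Pi.single i (1 : ℝ))
      (Set.Icc (G.lo i) (G.hi i)) (x i) := (hasDerivAt_update x i (x i)).hasDerivWithinAt
  have hmaps : Set.MapsTo (Function.update x i) (Set.Icc (G.lo i) (G.hi i)) G.domain := by
    intro s hs j _
    by_cases hj : j = i
    · subst hj; simpa using hs
    · simpa [hj] using hx j (Set.mem_univ j)
  exact (hd.comp_hasDerivWithinAt (x i) hup hmaps).derivWithin
    (uniqueDiffOn_Icc (hlt i) _ hxi)

/-- Functions of class `C^{p(k+1)}` on `Ω` have well defined grid data. -/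
theorem matchesData_gridData (k : ℕ) (φ : (Fin p → ℝ) → ℝ)
    (hφ : ContDiffOn ℝ ((p * (k + 1) : ℕ) : WithTop ℕ∞) φ G.domain) :
    G.CellwiseSmooth ((p * (k + 1) : ℕ) : WithTop ℕ∞) φ ∧
      G.MatchesData k (G.gridData k φ) φ := by
  have hsub : ∀ c, G.openCell c ⊆ G.domain := fun c x hx i hi =>
    ⟨((G.node_strictMono i).monotone (Fin.zero_le _)).trans (hx i hi).1.le,
      (hx i hi).2.le.trans ((G.node_strictMono i).monotone (Fin.le_last _))⟩
  refine ⟨fun c => hφ.mono (hsub c), fun c q α => ?_⟩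
  have hit : ∀ (i : Fin p) (a n : ℕ) (f : (Fin p → ℝ) → ℝ),
      ContDiffOn ℝ ((n + a : ℕ) : WithTop ℕ∞) f G.domain →
      ContDiffOn ℝ (n : WithTop ℕ∞) ((G.pderiv i)^[a] f) G.domain := by
    intro i a
    induction a with
    | zero => intro n f hf; simpa using hf
    | succ a ih =>
      intro n f hf
      rw [Function.iterate_succ_apply']
      refine G.contDiffOn_pderiv i _ n (ih (n + 1) f ?_)
      rwa [show n + 1 + a = n + (a + 1) by ring]
  have hfold : ∀ (l : List (Fin p)) (n : ℕ),
      ContDiffOn ℝ ((n + l.length * (k + 1) : ℕ) : WithTop ℕ∞) φ G.domain →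
      ContDiffOn ℝ (n : WithTop ℕ∞)
        (l.foldr (fun i g => (G.pderiv i)^[(α i : ℕ)] g) φ) G.domain := by
    intro l
    induction l with
    | nil => intro n hn; simpa using hn
    | cons i l ih =>
      intro n hn
      refine hit i _ n _ (ih _ (hn.of_le ?_))
      have := (α i).isLt
      simp only [List.length_cons]
      exact_mod_cast (by nlinarith : n + (α i : ℕ) + l.length * (k + 1)
        ≤ n + (l.length + 1) * (k + 1))
  have hc := (hfold (List.finRange p) 0 (by simpa using hφ)).continuousOn
  have hmem : G.point (G.vertex c q) ∈ G.domain := fun i _ =>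
    ⟨(G.node_strictMono i).monotone (Fin.zero_le _),
      (G.node_strictMono i).monotone (Fin.le_last _)⟩
  exact (hc _ hmem).mono_left (nhdsWithin_mono _ (hsub c))

end RectGrid

end

/-! ### Partial derivatives on product sets and of tensor products -/

noncomputable section
namespace RectGrid
variable {p : ℕ} (G : RectGrid p)

/-! Everything is decided in a single cell. There the interpolant `H` is a sum of products of
univariate polynomials of degree at most `2k+1`, so `∂^β H` is a sum of products `∏ P_i(x_i)` with
`P_i` of degree at most `k`. Let `ψ` have the same data and put `u = ψ - H`; all derivatives of `u`
of order at most `k` in each variable tend to `0` at the vertices. Integrating `(∏ P_i) ∂^β u` by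
parts `k+1` times in every variable removes every integral, because `P_i^(k+1) = 0`, and leaves only
vertex values of those derivatives (`integral_prod_eval_mul_eq_sum`). Hence `∂^β H` is orthogonal to
`∂^β u` (`orthogonality`). Integrating `(∂^β ψ)^2 ≥ (∂^β H)^2 + 2 ∂^β H ∂^β u` gives minimality on
the cell, and summing over cells, which overlap only in null sets, gives it on `Ω`. The comparison
with `φ` is the case `ψ = φ`.

Two points need care. First, `ψ` is smooth only inside the cell and is controlled only at its
vertices. The integration by parts is therefore done on closed boxes exhausting the open cell; the
vertices of these boxes converge to the vertices of the cell from inside, which is exactly where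
matching the data gives limits (`integral_prod_eval_mul_mixedDeriv_eq_zero`).

Second, the derivatives of `H` at a grid point are taken within `Ω` and so see all adjoining cells
at once. For this `H` is written on all of `Ω` as one sum of tensor products of piecewise
polynomials (`interpolant_eq_sum_axisBasis`), whose derivatives of order at most `k` agree at the
nodes (`hasDerivWithinAt_axisBasis`). The mixed derivatives are then computed factor by factor. -/

theorem lo_lt_hi (i : Fin p) : G.lo i < G.hi i :=
  G.node_strictMono i (by rw [Fin.lt_def]; exact G.numCells_pos i)

/-- A product set in `Ω` on which derivatives within `Ω` in the direction of the axes only depend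
on the values in the set. -/
structure IsLocalBox (S : Fin p → Set ℝ) : Prop where
  subset : ∀ i, S i ⊆ Set.Icc (G.lo i) (G.hi i)
  nhds : ∀ i, ∀ t ∈ S i, 𝓝[Set.Icc (G.lo i) (G.hi i)] t = 𝓝[S i] t

theorem isLocalBox_domain : G.IsLocalBox fun i => Set.Icc (G.lo i) (G.hi i) :=
  ⟨fun _ => le_rfl, fun _ _ _ => rfl⟩

theorem cellLo_lt_cellHi (c : G.Cell) (i : Fin p) : G.cellLo c i < G.cellHi c i :=
  G.node_strictMono i Fin.castSucc_lt_succ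

theorem lo_le_cellLo (c : G.Cell) (i : Fin p) : G.lo i ≤ G.cellLo c i :=
  (G.node_strictMono i).monotone (Fin.zero_le _)

theorem cellHi_le_hi (c : G.Cell) (i : Fin p) : G.cellHi c i ≤ G.hi i :=
  (G.node_strictMono i).monotone (Fin.le_last _)

theorem isLocalBox_openCell (c : G.Cell) :
    G.IsLocalBox fun i => Set.Ioo (G.cellLo c i) (G.cellHi c i) := by
  refine ⟨fun i t ht => ⟨(G.lo_le_cellLo c i).trans ht.1.le, ht.2.le.trans (G.cellHi_le_hi c i)⟩,
    fun i t ht => ?_⟩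
  rw [IsOpen.nhdsWithin_eq isOpen_Ioo ht, nhdsWithin_eq_nhds]
  exact Icc_mem_nhds ((G.lo_le_cellLo c i).trans_lt ht.1) (ht.2.trans_le (G.cellHi_le_hi c i))

variable {G}

namespace IsLocalBox

variable {S : Fin p → Set ℝ} (hS : G.IsLocalBox S)
include hS

theorem eqOn_pderiv {f g : (Fin p → ℝ) → ℝ} (h : Set.EqOn f g (Set.univ.pi S)) (i : Fin p) :
    Set.EqOn (G.pderiv i f) (G.pderiv i g) (Set.univ.pi S) := by
  intro x hx
  have hmem : ∀ s ∈ S i, Function.update x i s ∈ Set.univ.pi S := by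
    intro s hs j _
    by_cases hj : j = i
    · subst hj; simpa using hs
    · simpa [hj] using hx j trivial
  refine Filter.EventuallyEq.derivWithin_eq ?_ (by simpa using h hx)
  rw [hS.nhds i _ (hx i trivial)]
  filter_upwards [self_mem_nhdsWithin] with s hs using h (hmem s hs)

theorem eqOn_iterate_pderiv {f g : (Fin p → ℝ) → ℝ} (h : Set.EqOn f g (Set.univ.pi S))
    (i : Fin p) (n : ℕ) :
    Set.EqOn ((G.pderiv i)^[n] f) ((G.pderiv i)^[n] g) (Set.univ.pi S) := by
  induction n with
  | zero => simpa using h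
  | succ n ih => simpa only [Function.iterate_succ_apply'] using hS.eqOn_pderiv ih i

theorem pderiv_eq {f : (Fin p → ℝ) → ℝ} {f' : ℝ} {x : Fin p → ℝ} {i : Fin p}
    (hx : x ∈ Set.univ.pi S)
    (h : HasDerivWithinAt (fun s => f (Function.update x i s)) f' (S i) (x i)) :
    G.pderiv i f x = f' := by
  refine HasDerivWithinAt.derivWithin ?_
    (uniqueDiffOn_Icc (G.lo_lt_hi i) _ (hS.subset i (hx i trivial)))
  refine h.mono_of_mem_nhdsWithin ?_
  rw [hS.nhds i _ (hx i trivial)]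
  exact self_mem_nhdsWithin

variable {ι : Type*} [Fintype ι] (coef : ι → ℝ) (U : ι → Fin p → ℕ → ℝ → ℝ)

/-- Only the `i`-th factor of each term depends on the `i`-th variable. `U l j b` stands for the
derivative of order `b` of the `j`-th factor of the term `l`. These derivatives are supplied as a
family because the same computation serves polynomials on an open cell and, on all of `Ω`, piecewise
polynomials differentiable only to a limited order. -/
theorem eqOn_pderiv_tensor {f : (Fin p → ℝ) → ℝ} (e : Fin p → ℕ) (i : Fin p)
    (hU : ∀ l, ∀ t ∈ S i, HasDerivWithinAt (U l i (e i)) (U l i (e i + 1) t) (S i) t)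
    (hf : Set.EqOn f (fun x => ∑ l, coef l * ∏ j, U l j (e j) (x j)) (Set.univ.pi S)) :
    Set.EqOn (G.pderiv i f)
      (fun x => ∑ l, coef l * ∏ j, U l j (Function.update e i (e i + 1) j) (x j))
      (Set.univ.pi S) := by
  intro x hx
  rw [hS.eqOn_pderiv hf i hx]
  refine hS.pderiv_eq hx ?_
  refine HasDerivWithinAt.fun_sum fun l _ => HasDerivWithinAt.const_mul _ ?_
  have h1 : (fun s => ∏ j, U l j (e j) (Function.update x i s j)) =
      fun s => U l i (e i) s * ∏ j ∈ Finset.univ.erase i, U l j (e j) (x j) := by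
    funext s
    rw [← Finset.mul_prod_erase _ _ (Finset.mem_univ i)]
    congr 1
    · simp
    · refine Finset.prod_congr rfl fun j hj => ?_
      rw [Function.update_of_ne (Finset.ne_of_mem_erase hj)]
  have h2 : ∏ j, U l j (Function.update e i (e i + 1) j) (x j) =
      U l i (e i + 1) (x i) * ∏ j ∈ Finset.univ.erase i, U l j (e j) (x j) := by
    rw [← Finset.mul_prod_erase _ _ (Finset.mem_univ i)]
    congr 1
    · simp
    · refine Finset.prod_congr rfl fun j hj => ?_
      rw [Function.update_of_ne (Finset.ne_of_mem_erase hj)]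
  rw [h1, h2]
  exact (hU l _ (hx i trivial)).mul_const _

/-- Mixed derivatives of a sum of tensor products are computed factor by factor. -/
theorem eqOn_mixedDeriv_tensor {f : (Fin p → ℝ) → ℝ} (γ : Fin p → ℕ)
    (hU : ∀ l i b, b < γ i → ∀ t ∈ S i, HasDerivWithinAt (U l i b) (U l i (b + 1) t) (S i) t)
    (hf : Set.EqOn f (fun x => ∑ l, coef l * ∏ j, U l j 0 (x j)) (Set.univ.pi S)) :
    Set.EqOn (G.mixedDeriv γ f) (fun x => ∑ l, coef l * ∏ j, U l j (γ j) (x j))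
      (Set.univ.pi S) := by
  have hit : ∀ (f : (Fin p → ℝ) → ℝ) (e : Fin p → ℕ) (i : Fin p) (n : ℕ), e i + n ≤ γ i →
      Set.EqOn f (fun x => ∑ l, coef l * ∏ j, U l j (e j) (x j)) (Set.univ.pi S) →
      Set.EqOn ((G.pderiv i)^[n] f)
        (fun x => ∑ l, coef l * ∏ j, U l j (Function.update e i (e i + n) j) (x j))
        (Set.univ.pi S) := by
    intro f e i n
    induction n with
    | zero => intro _ h; simpa using h
    | succ n ih =>
      intro hn h
      rw [Function.iterate_succ_apply']
      have := hS.eqOn_pderiv_tensor coef U _ i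
        (fun l t ht => hU l i _ (by simp; omega) t ht) (ih (by omega) h)
      simpa [add_assoc] using this
  -- Each direction occurs once, so when `∂_i` is reached the `i`-th factors are still
  -- undifferentiated.
  have hl : ∀ L : List (Fin p), L.Nodup →
      Set.EqOn (L.foldr (fun i g => (G.pderiv i)^[γ i] g) f)
        (fun x => ∑ l, coef l * ∏ j, U l j (if j ∈ L then γ j else 0) (x j))
        (Set.univ.pi S) := by
    intro L
    induction L with
    | nil => intro _; simpa using hf
    | cons i L ih =>
      intro hL
      have hi : i ∉ L := (List.nodup_cons.1 hL).1
      have h := hit _ _ i (γ i) (by simp [hi]) (ih (List.nodup_cons.1 hL).2)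
      intro x hx
      rw [List.foldr_cons, h hx]
      refine Finset.sum_congr rfl fun l _ => ?_
      congr 1
      refine Finset.prod_congr rfl fun j _ => ?_
      by_cases hj : j = i
      · subst hj; simp [hi]
      · simp [hj]
  exact (hl _ (List.nodup_finRange p)).trans fun x _ => by simp

end IsLocalBox

/-! ### Mixed derivatives of smooth functions inside a cell -/

variable (G)

theorem isOpen_openCell (c : G.Cell) : IsOpen (G.openCell c) :=
  isOpen_set_pi Set.finite_univ fun _ _ => isOpen_Ioo

theorem hasDerivAt_update_of_differentiableAt {f : (Fin p → ℝ) → ℝ} {x : Fin p → ℝ}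
    (h : DifferentiableAt ℝ f x) (i : Fin p) :
    HasDerivAt (fun s => f (Function.update x i s)) (fderiv ℝ f x (Pi.single i 1)) (x i) := by
  have hd : HasFDerivAt f (fderiv ℝ f x) (Function.update x i (x i)) := by
    rw [Function.update_eq_self]; exact h.hasFDerivAt
  exact hd.comp_hasDerivAt (x i) (hasDerivAt_update x i (x i))

variable {c : G.Cell} {f g : (Fin p → ℝ) → ℝ}

theorem pderiv_eq_fderiv {x : Fin p → ℝ} (hx : x ∈ G.openCell c) (h : DifferentiableAt ℝ f x)
    (i : Fin p) : G.pderiv i f x = fderiv ℝ f x (Pi.single i 1) :=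
  (G.isLocalBox_openCell c).pderiv_eq hx
    (hasDerivAt_update_of_differentiableAt h i).hasDerivWithinAt

theorem differentiableAt_of_contDiffOn {n : ℕ} (hn : 0 < n)
    (hf : ContDiffOn ℝ (n : WithTop ℕ∞) f (G.openCell c)) {x : Fin p → ℝ}
    (hx : x ∈ G.openCell c) : DifferentiableAt ℝ f x :=
  (hf.contDiffAt ((G.isOpen_openCell c).mem_nhds hx)).differentiableAt
    (by exact_mod_cast hn.ne')

theorem contDiffOn_openCell_pderiv {n : ℕ} (i : Fin p)
    (hf : ContDiffOn ℝ ((n + 1 : ℕ) : WithTop ℕ∞) f (G.openCell c)) :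
    ContDiffOn ℝ (n : WithTop ℕ∞) (G.pderiv i f) (G.openCell c) := by
  have h1 : ContDiffOn ℝ (n : WithTop ℕ∞) (fun x => fderiv ℝ f x (Pi.single i 1))
      (G.openCell c) :=
    (hf.fderiv_of_isOpen (G.isOpen_openCell c) (m := (n : WithTop ℕ∞))
      (by exact_mod_cast le_rfl)).clm_apply contDiffOn_const
  exact h1.congr fun x hx =>
    G.pderiv_eq_fderiv hx (G.differentiableAt_of_contDiffOn n.succ_pos hf hx) i

theorem contDiffOn_openCell_iterate_pderiv (i : Fin p) (a n : ℕ)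
    (hf : ContDiffOn ℝ ((n + a : ℕ) : WithTop ℕ∞) f (G.openCell c)) :
    ContDiffOn ℝ (n : WithTop ℕ∞) ((G.pderiv i)^[a] f) (G.openCell c) := by
  induction a generalizing n with
  | zero => simpa using hf
  | succ a ih =>
    rw [Function.iterate_succ_apply']
    refine G.contDiffOn_openCell_pderiv i (ih (n + 1) ?_)
    rwa [show n + 1 + a = n + (a + 1) by ring]

theorem contDiffOn_openCell_foldr (γ : Fin p → ℕ) (L : List (Fin p)) (n : ℕ)
    (hf : ContDiffOn ℝ ((n + (L.map γ).sum : ℕ) : WithTop ℕ∞) f (G.openCell c)) :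
    ContDiffOn ℝ (n : WithTop ℕ∞) (L.foldr (fun i g => (G.pderiv i)^[γ i] g) f)
      (G.openCell c) := by
  induction L generalizing n with
  | nil => simpa using hf
  | cons i L ih =>
    refine G.contDiffOn_openCell_iterate_pderiv i _ n (ih _ ?_)
    rwa [add_assoc, ← List.sum_cons, ← List.map_cons]

theorem contDiffOn_openCell_mixedDeriv (γ : Fin p → ℕ) (n : ℕ)
    (hf : ContDiffOn ℝ ((n + ∑ i, γ i : ℕ) : WithTop ℕ∞) f (G.openCell c)) :
    ContDiffOn ℝ (n : WithTop ℕ∞) (G.mixedDeriv γ f) (G.openCell c) := by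
  refine G.contDiffOn_openCell_foldr γ _ n ?_
  rwa [← List.ofFn_eq_map, List.sum_ofFn]

/-- Inside the cell both sides are values of the second Fréchet derivative on two basis vectors, and
this derivative is symmetric. -/
theorem pderiv_comm (i j : Fin p)
    (hf : ContDiffOn ℝ (2 : ℕ) f (G.openCell c)) :
    Set.EqOn (G.pderiv i (G.pderiv j f)) (G.pderiv j (G.pderiv i f)) (G.openCell c) := by
  have key : ∀ i j, ∀ x ∈ G.openCell c, G.pderiv i (G.pderiv j f) x =
      fderiv ℝ (fderiv ℝ f) x (Pi.single i 1) (Pi.single j 1) := by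
    intro i j x hx
    have h1 : Set.EqOn (G.pderiv j f) (fun y => fderiv ℝ f y (Pi.single j 1)) (G.openCell c) :=
      fun y hy => G.pderiv_eq_fderiv hy (G.differentiableAt_of_contDiffOn two_pos hf hy) j
    have h2 : DifferentiableAt ℝ (fderiv ℝ f) x :=
      ((hf.fderiv_of_isOpen (G.isOpen_openCell c) (m := 1)
        (by norm_num)).contDiffAt ((G.isOpen_openCell c).mem_nhds hx)).differentiableAt
        (by norm_num)
    rw [(G.isLocalBox_openCell c).eqOn_pderiv h1 i hx, G.pderiv_eq_fderiv hx (by fun_prop) i,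
      fderiv_clm_apply h2 (by fun_prop)]
    simp
  intro x hx
  rw [key i j x hx, key j i x hx]
  exact ((hf.contDiffAt ((G.isOpen_openCell c).mem_nhds hx)).isSymmSndFDerivAt
    (by simp)).eq _ _

theorem pderiv_iterate_comm (i j : Fin p) (a : ℕ)
    (hf : ContDiffOn ℝ ((a + 1 : ℕ) : WithTop ℕ∞) f (G.openCell c)) :
    Set.EqOn (G.pderiv i ((G.pderiv j)^[a] f)) ((G.pderiv j)^[a] (G.pderiv i f))
      (G.openCell c) := by
  induction a with
  | zero => exact fun _ _ => rfl
  | succ a ih =>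
    rw [Function.iterate_succ_apply', Function.iterate_succ_apply']
    refine (G.pderiv_comm i j (G.contDiffOn_openCell_iterate_pderiv j a 2 ?_)).trans ?_
    · rwa [show 2 + a = a + 1 + 1 by ring]
    · exact (G.isLocalBox_openCell c).eqOn_pderiv
        (ih (hf.of_le (by exact_mod_cast Nat.le_succ _))) j

/-- `mixedDeriv` applies the directions in a fixed order, so the outer `∂_i` has to be moved inwards
past the other directions until it meets its own block of derivatives. This makes the mixed
derivatives a family closed under differentiation, as integration by parts requires. -/
theorem pderiv_mixedDeriv (i : Fin p) (γ : Fin p → ℕ)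
    (hf : ContDiffOn ℝ ((∑ i, γ i + 1 : ℕ) : WithTop ℕ∞) f (G.openCell c)) :
    Set.EqOn (G.pderiv i (G.mixedDeriv γ f))
      (G.mixedDeriv (Function.update γ i (γ i + 1)) f) (G.openCell c) := by
  have hl : ∀ L : List (Fin p), L.Nodup → i ∈ L →
      ContDiffOn ℝ (((L.map γ).sum + 1 : ℕ) : WithTop ℕ∞) f (G.openCell c) →
      Set.EqOn (G.pderiv i (L.foldr (fun i g => (G.pderiv i)^[γ i] g) f))
        (L.foldr (fun j g => (G.pderiv j)^[Function.update γ i (γ i + 1) j] g) f)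
        (G.openCell c) := by
    intro L
    induction L with
    | nil => intro _ h; simp at h
    | cons j L ih =>
      intro hL hi hf
      obtain ⟨hj, hL⟩ := List.nodup_cons.1 hL
      rw [List.map_cons, List.sum_cons] at hf
      by_cases hij : i = j
      · subst hij
        have h1 : L.foldr (fun j g => (G.pderiv j)^[Function.update γ i (γ i + 1) j] g) f =
            L.foldr (fun i g => (G.pderiv i)^[γ i] g) f :=
          List.foldr_ext _ _ _ fun l hl' g => by
            rw [Function.update_of_ne (ne_of_mem_of_not_mem hl' hj)]
        rw [List.foldr_cons, List.foldr_cons, h1, Function.update_self,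
          Function.iterate_succ_apply']
        exact fun _ _ => rfl
      · rw [List.foldr_cons, List.foldr_cons, Function.update_of_ne (Ne.symm hij)]
        refine (G.pderiv_iterate_comm i j _ (G.contDiffOn_openCell_foldr γ L _ ?_)).trans ?_
        · rwa [show γ j + 1 + (L.map γ).sum = γ j + (L.map γ).sum + 1 by ring]
        · refine (G.isLocalBox_openCell c).eqOn_iterate_pderiv (ih hL ?_ (hf.of_le ?_)) j _
          · simpa [hij] using hi
          · exact_mod_cast (by omega)
  refine hl _ (List.nodup_finRange p) (List.mem_finRange i) ?_
  rwa [← List.ofFn_eq_map, List.sum_ofFn]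

/-- `derivWithin` is additive only where both functions are differentiable, so the smoothness is
used at every stage of the iteration. -/
theorem mixedDeriv_sub (γ : Fin p → ℕ)
    (hf : ContDiffOn ℝ ((∑ i, γ i : ℕ) : WithTop ℕ∞) f (G.openCell c))
    (hg : ContDiffOn ℝ ((∑ i, γ i : ℕ) : WithTop ℕ∞) g (G.openCell c)) :
    Set.EqOn (G.mixedDeriv γ fun x => f x - g x)
      (fun x => G.mixedDeriv γ f x - G.mixedDeriv γ g x) (G.openCell c) := by
  have hbox := G.isLocalBox_openCell c
  have hit : ∀ (i : Fin p) (a : ℕ) (f g h : (Fin p → ℝ) → ℝ),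
      ContDiffOn ℝ (a : WithTop ℕ∞) f (G.openCell c) →
      ContDiffOn ℝ (a : WithTop ℕ∞) g (G.openCell c) →
      Set.EqOn h (fun x => f x - g x) (G.openCell c) →
      Set.EqOn ((G.pderiv i)^[a] h)
        (fun x => (G.pderiv i)^[a] f x - (G.pderiv i)^[a] g x) (G.openCell c) := by
    intro i a f g h hf hg hh
    induction a with
    | zero => simpa using hh
    | succ a ih =>
      intro x hx
      have hle : (a : WithTop ℕ∞) ≤ ((a + 1 : ℕ) : WithTop ℕ∞) := by
        exact_mod_cast Nat.le_succ a
      simp only [Function.iterate_succ_apply']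
      have df := G.differentiableAt_of_contDiffOn one_pos
        (G.contDiffOn_openCell_iterate_pderiv i a 1 (by rwa [add_comm])) hx (f := (G.pderiv i)^[a] f)
      have dg := G.differentiableAt_of_contDiffOn one_pos
        (G.contDiffOn_openCell_iterate_pderiv i a 1 (by rwa [add_comm])) hx (f := (G.pderiv i)^[a] g)
      rw [hbox.eqOn_pderiv (ih (hf.of_le hle) (hg.of_le hle)) i hx,
        G.pderiv_eq_fderiv hx df i, G.pderiv_eq_fderiv hx dg i,
        G.pderiv_eq_fderiv hx (df.fun_sub dg) i, fderiv_fun_sub df dg]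
      rfl
  have hl : ∀ L : List (Fin p),
      ContDiffOn ℝ ((L.map γ).sum : WithTop ℕ∞) f (G.openCell c) →
      ContDiffOn ℝ ((L.map γ).sum : WithTop ℕ∞) g (G.openCell c) →
      Set.EqOn (L.foldr (fun i g => (G.pderiv i)^[γ i] g) fun x => f x - g x)
        (fun x => L.foldr (fun i g => (G.pderiv i)^[γ i] g) f x -
          L.foldr (fun i g => (G.pderiv i)^[γ i] g) g x) (G.openCell c) := by
    intro L
    induction L with
    | nil => intro _ _ x _; rfl
    | cons i L ih =>
      intro hf hg
      rw [List.map_cons, List.sum_cons] at hf hg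
      have hle : ((L.map γ).sum : WithTop ℕ∞) ≤ ((γ i + (L.map γ).sum : ℕ) : WithTop ℕ∞) := by
        exact_mod_cast Nat.le_add_left _ _
      exact hit i _ _ _ _ (G.contDiffOn_openCell_foldr γ L _ hf)
        (G.contDiffOn_openCell_foldr γ L _ hg) (ih (hf.of_le hle) (hg.of_le hle))
  refine hl _ ?_ ?_ <;> rwa [← List.ofFn_eq_map, List.sum_ofFn]

end RectGrid
end

/-! ### Repeated integration by parts over a box -/

noncomputable section

open MeasureTheory

/-- The weight of the boundary term with the derivative of order `e.2` at the end point with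
index `e.1`, when `P * u^(k+1)` is integrated by parts `k + 1` times over `[a, b]`. -/
def boundaryCoeff (k : ℕ) (P : ℝ[X]) (a b : ℝ) (e : Fin 2 × Fin (k + 1)) : ℝ :=
  (if e.1 = 0 then -1 else 1) * (-1) ^ (k - (e.2 : ℕ)) *
    (Polynomial.derivative^[k - (e.2 : ℕ)] P).eval (if e.1 = 0 then a else b)

/-- The alternating sum `∑ (-1)^(k-j) P^(k-j) u^(j)` over `j ≤ k` is an antiderivative of `P
u^(k+1)`, so all integrations by parts are done at once by the fundamental theorem of calculus. -/
theorem integral_eval_mul_eq_sum (k : ℕ) (P : ℝ[X]) (hP : Polynomial.derivative^[k + 1] P = 0)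
    {a b : ℝ} (hab : a ≤ b) (u : ℕ → ℝ → ℝ)
    (hu : ∀ j ≤ k, ∀ s ∈ Set.Icc a b, HasDerivAt (u j) (u (j + 1) s) s)
    (hc : ContinuousOn (u (k + 1)) (Set.Icc a b)) :
    ∫ s in Set.Icc a b, P.eval s * u (k + 1) s =
      ∑ e : Fin 2 × Fin (k + 1),
        boundaryCoeff k P a b e * u (e.2 : ℕ) (if e.1 = 0 then a else b) := by
  set W : ℝ → ℝ := fun s => ∑ j ∈ Finset.range (k + 1),
    (-1) ^ (k - j) * ((Polynomial.derivative^[k - j] P).eval s * u j s) with hW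
  have hd : ∀ s ∈ Set.uIcc a b, HasDerivAt W (P.eval s * u (k + 1) s) s := by
    intro s hs
    rw [Set.uIcc_of_le hab] at hs
    -- The derivative of `W` telescopes to `T (k + 1) - T 0`: the first is the integrand, the second
    -- contains `P^(k+1) = 0`.
    set T : ℕ → ℝ := fun j => (-1) ^ (k + 1 - j) *
      ((Polynomial.derivative^[k + 1 - j] P).eval s * u j s) with hT
    have h1 : P.eval s * u (k + 1) s = ∑ j ∈ Finset.range (k + 1), (T (j + 1) - T j) := by
      rw [Finset.sum_range_sub]
      simp [hT, hP]
    rw [h1, hW]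
    refine HasDerivAt.fun_sum fun j hj => ?_
    have hj' : j ≤ k := Nat.lt_succ_iff.1 (Finset.mem_range.1 hj)
    have h2 := (((Polynomial.derivative^[k - j] P).hasDerivAt s).mul (hu j hj' s hs)).const_mul
      ((-1 : ℝ) ^ (k - j))
    refine h2.congr_deriv ?_
    have h3 : k + 1 - j = k - j + 1 := by omega
    simp only [hT, Nat.add_sub_add_right, h3, Function.iterate_succ_apply']
    ring
  have hint : IntervalIntegrable (fun s => P.eval s * u (k + 1) s) volume a b :=
    ContinuousOn.intervalIntegrable (by
      rw [Set.uIcc_of_le hab]; exact P.continuous.continuousOn.mul hc)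
  rw [integral_Icc_eq_integral_Ioc, ← intervalIntegral.integral_of_le hab,
    intervalIntegral.integral_eq_sub_of_hasDerivAt hd hint, Fintype.sum_prod_type,
    Fin.sum_univ_two, hW]
  simp only [boundaryCoeff, Finset.sum_range, if_true, one_ne_zero, if_false]
  rw [sub_eq_neg_add, ← Finset.sum_neg_distrib]
  congr 1 <;> exact Finset.sum_congr rfl fun j _ => by ring

theorem preimage_piFinSuccAbove_symm_Icc {p : ℕ} (a b : Fin (p + 1) → ℝ) :
    (MeasurableEquiv.piFinSuccAbove (fun _ : Fin (p + 1) => ℝ) 0).symm ⁻¹' Set.Icc a b =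
      Set.Icc (a 0) (b 0) ×ˢ Set.Icc (Fin.tail a) (Fin.tail b) := by
  ext ⟨x, y⟩
  simp only [Set.mem_preimage, MeasurableEquiv.piFinSuccAbove_symm_apply, Set.mem_prod,
    Set.mem_Icc, Pi.le_def, Fin.forall_fin_succ, Fin.tail]
  simp [Fin.insertNthEquiv]
  tauto

theorem integral_Icc_fin_succ {p : ℕ} (a b : Fin (p + 1) → ℝ) (F : (Fin (p + 1) → ℝ) → ℝ)
    (hF : ContinuousOn F (Set.Icc a b)) :
    ∫ x in Set.Icc a b, F x = ∫ s in Set.Icc (a 0) (b 0),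
      ∫ y in Set.Icc (Fin.tail a) (Fin.tail b), F (Fin.cons s y) := by
  have mp := (volume_preserving_piFinSuccAbove (fun _ : Fin (p + 1) => ℝ) 0).symm
  have h := mp.setIntegral_preimage_emb (MeasurableEquiv.measurableEmbedding _) F (Set.Icc a b)
  have hi := (mp.integrableOn_comp_preimage (MeasurableEquiv.measurableEmbedding _)
    (f := F) (s := Set.Icc a b)).2 (hF.integrableOn_compact isCompact_Icc)
  rw [preimage_piFinSuccAbove_symm_Icc] at h hi
  rw [← h, Measure.volume_eq_prod, setIntegral_prod
    (fun z => F ((MeasurableEquiv.piFinSuccAbove (fun _ => ℝ) 0).symm z)) hi]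
  simp [MeasurableEquiv.piFinSuccAbove_symm_apply, Fin.insertNthEquiv]

/-- Integration by parts, `k + 1` times in every variable, over a box: if `g γ` is the mixed
derivative of order `γ` of a function, and the `P i` are polynomials of degree at most `k`, then
the integral of `(∏ P i) * g (k+1, …, k+1)` is a combination of values at the vertices of the
derivatives of order at most `k` in each variable. -/
theorem integral_prod_eval_mul_eq_sum (k : ℕ) {p : ℕ} (a b : Fin p → ℝ) (hab : a ≤ b)
    (P : Fin p → ℝ[X]) (hP : ∀ i, Polynomial.derivative^[k + 1] (P i) = 0)
    (g : (Fin p → ℕ) → (Fin p → ℝ) → ℝ)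
    (hc : ∀ γ : Fin p → ℕ, (∀ i, γ i ≤ k + 1) → ContinuousOn (g γ) (Set.Icc a b))
    (hd : ∀ γ : Fin p → ℕ, (∀ i, γ i ≤ k + 1) → ∀ i, γ i ≤ k → ∀ x ∈ Set.Icc a b,
      HasDerivAt (fun s => g γ (Function.update x i s))
        (g (Function.update γ i (γ i + 1)) x) (x i)) :
    ∫ x in Set.Icc a b, (∏ i, (P i).eval (x i)) * g (fun _ => k + 1) x =
      ∑ e : Fin p → Fin 2 × Fin (k + 1), (∏ i, boundaryCoeff k (P i) (a i) (b i) (e i)) *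
        g (fun i => ((e i).2 : ℕ)) (fun i => if (e i).1 = 0 then a i else b i) := by
  induction p with
  | zero =>
    have h1 : Set.Icc a b = Set.univ := Set.eq_univ_of_forall fun x => by
      rw [Subsingleton.elim x a]; exact ⟨le_rfl, hab⟩
    rw [h1, Measure.restrict_univ, integral_unique]
    simp only [Finset.univ_eq_empty, Finset.prod_empty, one_mul, Fintype.sum_unique]
    -- On the one-point space `ℝ^0` the volume is a Dirac mass, so the integral is the value at the
    -- point.
    have hv : (volume : Measure (Fin 0 → ℝ)).real Set.univ = 1 := by
      rw [Measure.volume_pi_eq_dirac a]; simp [Measure.real]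
    rw [hv, one_smul]
    exact congrArg₂ g (Subsingleton.elim _ _) (Subsingleton.elim _ _)
  | succ p ih =>
    have hcontP : Continuous fun x : Fin (p + 1) → ℝ => ∏ i, (P i).eval (x i) :=
      continuous_finsetProd _ fun i _ => (P i).continuous.comp (continuous_apply i)
    have hcont : ContinuousOn (fun x => (∏ i, (P i).eval (x i)) * g (fun _ => k + 1) x)
        (Set.Icc a b) := hcontP.continuousOn.mul (hc _ fun _ => le_rfl)
    rw [integral_Icc_fin_succ _ _ _ hcont]
    have hmem : ∀ s ∈ Set.Icc (a 0) (b 0), ∀ y ∈ Set.Icc (Fin.tail a) (Fin.tail b),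
        (Fin.cons s y : Fin (p + 1) → ℝ) ∈ Set.Icc a b := by
      intro s hs y hy
      constructor <;> intro i <;> refine Fin.cases ?_ (fun i => ?_) i
      · simpa using hs.1
      · simpa [Fin.tail] using hy.1 i
      · simpa using hs.2
      · simpa [Fin.tail] using hy.2 i
    have hle : ∀ (n : ℕ) (γ : Fin p → ℕ), n ≤ k + 1 → (∀ i, γ i ≤ k + 1) →
        ∀ i, (Fin.cons n γ : Fin (p + 1) → ℕ) i ≤ k + 1 := by
      intro n γ hn hγ i
      refine Fin.cases ?_ (fun i => ?_) i
      · simpa using hn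
      · simpa using hγ i
    have hbeta : (fun _ => k + 1 : Fin (p + 1) → ℕ) =
        Fin.cons (k + 1) (fun _ => k + 1 : Fin p → ℕ) := by
      funext i; refine Fin.cases ?_ (fun i => ?_) i <;> simp
    have habt : Fin.tail a ≤ Fin.tail b := fun i => hab i.succ
    have hvert : ∀ e : Fin p → Fin 2 × Fin (k + 1),
        (fun i => if (e i).1 = 0 then Fin.tail a i else Fin.tail b i) ∈
          Set.Icc (Fin.tail a) (Fin.tail b) := by
      intro e
      constructor <;> intro i <;> dsimp only <;> split_ifs
      exacts [le_rfl, habt i, habt i, le_rfl]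
    -- The induction hypothesis is applied to the slice with first coordinate `s`, the order in the
    -- first variable being frozen at `k + 1`.
    have hinner : ∀ s ∈ Set.Icc (a 0) (b 0), ∫ y in Set.Icc (Fin.tail a) (Fin.tail b),
        (∏ i, (P i).eval ((Fin.cons s y : Fin (p + 1) → ℝ) i)) *
          g (fun _ => k + 1) (Fin.cons s y) =
        ∑ e : Fin p → Fin 2 × Fin (k + 1),
          (∏ i, boundaryCoeff k (P i.succ) (a i.succ) (b i.succ) (e i)) *
          ((P 0).eval s * g (Fin.cons (k + 1) fun i => ((e i).2 : ℕ))
            (Fin.cons s fun i => if (e i).1 = 0 then Fin.tail a i else Fin.tail b i)) := by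
      intro s hs
      have h := ih (Fin.tail a) (Fin.tail b) habt (Fin.tail P) (fun i => hP i.succ)
        (fun γ y => g (Fin.cons (k + 1) γ) (Fin.cons s y))
        (fun γ hγ => (hc _ (hle _ γ le_rfl hγ)).comp
          (Continuous.continuousOn (by fun_prop)) fun y hy => hmem s hs y hy)
        (fun γ hγ i hi y hy => by
          have := hd _ (hle _ γ le_rfl hγ) i.succ (by simpa using hi) _ (hmem s hs y hy)
          simpa only [← Fin.cons_update, Fin.cons_succ] using this)
      simp only [Fin.prod_univ_succ, Fin.cons_zero, Fin.cons_succ, mul_assoc]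
      rw [integral_const_mul, hbeta]
      simp only [Fin.tail] at h ⊢
      rw [h, Finset.mul_sum]
      exact Finset.sum_congr rfl fun e _ => by ring
    rw [setIntegral_congr_fun measurableSet_Icc hinner, integral_finsetSum]
    · have h1 : ∀ e : Fin p → Fin 2 × Fin (k + 1),
          ∫ s in Set.Icc (a 0) (b 0),
            (∏ i, boundaryCoeff k (P i.succ) (a i.succ) (b i.succ) (e i)) *
            ((P 0).eval s * g (Fin.cons (k + 1) fun i => ((e i).2 : ℕ))
              (Fin.cons s fun i => if (e i).1 = 0 then Fin.tail a i else Fin.tail b i)) =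
          ∑ e0 : Fin 2 × Fin (k + 1),
            (∏ i, boundaryCoeff k (P i.succ) (a i.succ) (b i.succ) (e i)) *
            (boundaryCoeff k (P 0) (a 0) (b 0) e0 *
              g (Fin.cons (e0.2 : ℕ) fun i => ((e i).2 : ℕ))
              (Fin.cons (if e0.1 = 0 then a 0 else b 0)
                fun i => if (e i).1 = 0 then Fin.tail a i else Fin.tail b i)) := by
        intro e
        have he : ∀ i, ((e i).2 : ℕ) ≤ k + 1 := fun i => (e i).2.isLt.le
        rw [integral_const_mul, integral_eval_mul_eq_sum k (P 0) (hP 0) (hab 0)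
          (fun j s => g (Fin.cons j fun i => ((e i).2 : ℕ))
            (Fin.cons s fun i => if (e i).1 = 0 then Fin.tail a i else Fin.tail b i)) ?_ ?_,
          Finset.mul_sum]
        · intro j hj s hs
          have := hd _ (hle j _ (by omega) he) 0 (by simpa using hj) _ (hmem s hs _ (hvert e))
          simpa only [Fin.update_cons_zero, Fin.cons_zero] using this
        · exact (hc _ (hle _ _ le_rfl he)).comp (Continuous.continuousOn (by fun_prop))
            fun s hs => hmem s hs _ (hvert e)
      -- A choice of end point and order on the first axis together with choices on the others is
      -- one choice on all `p + 1` axes.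
      rw [Finset.sum_congr rfl fun e _ => h1 e, Finset.sum_comm, ← Fintype.sum_prod_type',
        ← (Fin.consEquiv fun _ => Fin 2 × Fin (k + 1)).sum_comp]
      refine Finset.sum_congr rfl fun e _ => ?_
      simp only [Fin.consEquiv, Equiv.coe_fn_mk, Fin.prod_univ_succ, Fin.cons_zero, Fin.cons_succ]
      rw [← mul_assoc, mul_comm (∏ i, _) (boundaryCoeff _ _ _ _ _)]
      congr 2
      · funext i; refine Fin.cases ?_ (fun i => ?_) i <;> simp
      · funext i; refine Fin.cases ?_ (fun i => ?_) i <;> simp [Fin.tail]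
    · intro e _
      refine ContinuousOn.integrableOn_compact isCompact_Icc (continuousOn_const.mul
        ((P 0).continuous.continuousOn.mul ((hc _ (hle _ _ le_rfl fun i =>
          (e i).2.isLt.le)).comp (Continuous.continuousOn (by fun_prop))
            fun s hs => hmem s hs _ (hvert e))))

end

/-! ### Univariate Hermite basis on a grid axis and the global form of the interpolant -/

noncomputable section

theorem Polynomial.iterate_derivative_comp_C_mul_X_sub_C (f : ℝ[X]) (s t : ℝ) (b : ℕ) :
    Polynomial.derivative^[b] (f.comp (C s * (X - C t))) =
      C (s ^ b) * (Polynomial.derivative^[b] f).comp (C s * (X - C t)) := by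
  induction b with
  | zero => simp
  | succ b ih =>
    rw [Function.iterate_succ_apply', ih, Function.iterate_succ_apply', derivative_C_mul,
      derivative_comp, derivative_C_mul, derivative_X_sub_C, pow_succ, C_mul]
    ring

namespace RectGrid
variable {p : ℕ} (G : RectGrid p)

/-- The Hermite basis polynomial of the grid point `m` of the axis `i` and the order of
differentiation `a`, on the cell `j` of that axis. It vanishes if `m` is not a vertex of `j`. -/
def basisPoly (k : ℕ) (i : Fin p) (j : Fin (G.numCells i)) (m : Fin (G.numCells i + 1))
    (a : ℕ) : ℝ[X] :=
  ∑ q : Fin 2, if (m : ℕ) = (j : ℕ) + (q : ℕ) then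
    Polynomial.C ((G.node i j.succ - G.node i j.castSucc) ^ a) * (hermiteBasis k a q).comp
      (Polynomial.C (G.node i j.succ - G.node i j.castSucc)⁻¹ *
        (Polynomial.X - Polynomial.C (G.node i j.castSucc))) else 0

theorem node_castSucc_lt_node_succ (i : Fin p) (j : Fin (G.numCells i)) :
    G.node i j.castSucc < G.node i j.succ :=
  G.node_strictMono i Fin.castSucc_lt_succ

theorem basisPoly_natDegree_le (k : ℕ) (i : Fin p) (j : Fin (G.numCells i))
    (m : Fin (G.numCells i + 1)) {a : ℕ} (ha : a ≤ k) :
    (G.basisPoly k i j m a).natDegree ≤ 2 * k + 1 := by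
  refine Polynomial.natDegree_sum_le_of_forall_le _ _ fun q _ => ?_
  split_ifs
  · refine (Polynomial.natDegree_C_mul_le _ _).trans (Polynomial.natDegree_comp_le.trans ?_)
    have h1 : (Polynomial.C (G.node i j.succ - G.node i j.castSucc)⁻¹ *
        (Polynomial.X - Polynomial.C (G.node i j.castSucc))).natDegree ≤ 1 :=
      (Polynomial.natDegree_C_mul_le _ _).trans (Polynomial.natDegree_X_sub_C_le _)
    calc _ ≤ (2 * k + 1) * 1 := Nat.mul_le_mul (hermiteBasis_natDegree_le k a q ha) h1
      _ = _ := mul_one _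
  · simp

/-- The chain rule produces `Δx^(-b)`, which the normalizing factor `Δx^a` cancels in the only case
`a = b` where the value is nonzero. The answer does not involve the cell `j`, which is what allows
the pieces to be glued. -/
theorem iterate_derivative_basisPoly_eval_node (k : ℕ) (i : Fin p) (j : Fin (G.numCells i))
    (m l : Fin (G.numCells i + 1)) {a b : ℕ} (ha : a ≤ k) (hb : b ≤ k) (r : Fin 2)
    (hl : (l : ℕ) = (j : ℕ) + (r : ℕ)) :
    (Polynomial.derivative^[b] (G.basisPoly k i j m a)).eval (G.node i l) =
      if m = l ∧ a = b then 1 else 0 := by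
  have hΔ : G.node i j.succ - G.node i j.castSucc ≠ 0 :=
    (sub_pos.2 (G.node_castSucc_lt_node_succ i j)).ne'
  have hr : (G.node i j.succ - G.node i j.castSucc)⁻¹ * (G.node i l - G.node i j.castSucc) =
      ((r : ℕ) : ℝ) := by
    fin_cases r
    · have : l = j.castSucc := Fin.ext (by simpa using hl)
      simp [this]
    · have : l = j.succ := Fin.ext (by simpa using hl)
      simp [this, hΔ]
  rw [basisPoly, Polynomial.iterate_derivative_sum, Polynomial.eval_finsetSum]
  have h1 : ∀ q : Fin 2, (Polynomial.derivative^[b] (if (m : ℕ) = (j : ℕ) + (q : ℕ) then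
      Polynomial.C ((G.node i j.succ - G.node i j.castSucc) ^ a) * (hermiteBasis k a q).comp
      (Polynomial.C (G.node i j.succ - G.node i j.castSucc)⁻¹ *
        (Polynomial.X - Polynomial.C (G.node i j.castSucc))) else 0)).eval (G.node i l) =
      if q = r then (if m = l ∧ a = b then 1 else 0) else 0 := by
    intro q
    split_ifs with h2 h3 h4 h5 h6
    · rw [Polynomial.iterate_derivative_C_mul,
        Polynomial.iterate_derivative_comp_C_mul_X_sub_C]
      simp only [Polynomial.eval_mul, Polynomial.eval_C, Polynomial.eval_comp,
        Polynomial.eval_sub, Polynomial.eval_X, hr, hermiteBasis_eval k a b q r ha hb]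
      rw [if_pos ⟨h4.2, h3⟩, h4.2, mul_one, ← mul_pow, mul_inv_cancel₀ hΔ, one_pow]
    · rw [Polynomial.iterate_derivative_C_mul,
        Polynomial.iterate_derivative_comp_C_mul_X_sub_C]
      simp only [Polynomial.eval_mul, Polynomial.eval_C, Polynomial.eval_comp,
        Polynomial.eval_sub, Polynomial.eval_X, hr, hermiteBasis_eval k a b q r ha hb]
      rw [if_neg fun h => h4 ⟨Fin.ext (by rw [h2, hl, h3]), h.1⟩]
      simp
    · rw [Polynomial.iterate_derivative_C_mul,
        Polynomial.iterate_derivative_comp_C_mul_X_sub_C]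
      simp only [Polynomial.eval_mul, Polynomial.eval_C, Polynomial.eval_comp,
        Polynomial.eval_sub, Polynomial.eval_X, hr, hermiteBasis_eval k a b q r ha hb]
      rw [if_neg fun h => h3 h.2]
      simp
    · exact absurd (by rw [h6.1, hl, h5]) h2
    · simp
    · simp
  rw [Finset.sum_congr rfl fun q _ => h1 q]
  simp

theorem exists_axisCell (i : Fin p) {t : ℝ} (ht : t ∈ Set.Icc (G.lo i) (G.hi i)) :
    ∃ j : Fin (G.numCells i), t ∈ Set.Icc (G.node i j.castSucc) (G.node i j.succ) := by
  have hN := G.numCells_pos i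
  have hex : ∃ n, ∃ h : n < G.numCells i, t ≤ G.node i (Fin.succ ⟨n, h⟩) := by
    refine ⟨G.numCells i - 1, by omega, ht.2.trans_eq (congrArg (G.node i) (Fin.ext ?_))⟩
    simp; omega
  classical
  -- The first cell whose right end is at least `t` works: by minimality, `t` exceeds the right end
  -- of the preceding cell.
  obtain ⟨hlt, hle⟩ := Nat.find_spec hex
  refine ⟨⟨Nat.find hex, hlt⟩, ?_, hle⟩
  rcases Nat.eq_zero_or_pos (Nat.find hex) with h0 | h0
  · refine le_trans (le_of_eq ?_) ht.1
    exact congrArg _ (Fin.ext (by simp [h0]))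
  · have hmin := Nat.find_min hex (Nat.sub_lt h0 one_pos)
    push Not at hmin
    refine le_trans (le_of_eq (congrArg _ (Fin.ext ?_))) (hmin (by omega)).le
    simp; omega

theorem eq_add_of_node_mem (i : Fin p) (j : Fin (G.numCells i)) (l : Fin (G.numCells i + 1))
    (h : G.node i l ∈ Set.Icc (G.node i j.castSucc) (G.node i j.succ)) :
    ∃ r : Fin 2, (l : ℕ) = (j : ℕ) + (r : ℕ) := by
  have h1 := Fin.le_def.1 ((G.node_strictMono i).le_iff_le.1 h.1)
  have h2 := Fin.le_def.1 ((G.node_strictMono i).le_iff_le.1 h.2)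
  simp only [Fin.val_castSucc, Fin.val_succ] at h1 h2
  exact ⟨⟨(l : ℕ) - j, by omega⟩, by simp; omega⟩

/-- Two different cells of an axis can share only a node, and there the derivatives of order at most
`k` are prescribed independently of the cell. -/
theorem basisPoly_eval_eq_of_mem (k : ℕ) (i : Fin p) (m : Fin (G.numCells i + 1)) {a b : ℕ}
    (ha : a ≤ k) (hb : b ≤ k) {t : ℝ} (j j' : Fin (G.numCells i))
    (hj : t ∈ Set.Icc (G.node i j.castSucc) (G.node i j.succ))
    (hj' : t ∈ Set.Icc (G.node i j'.castSucc) (G.node i j'.succ)) :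
    (Polynomial.derivative^[b] (G.basisPoly k i j m a)).eval t =
      (Polynomial.derivative^[b] (G.basisPoly k i j' m a)).eval t := by
  wlog hlt : j < j' generalizing j j'
  · rcases (not_lt.1 hlt).eq_or_lt with h | h
    · rw [h]
    · exact (this j' j hj' hj h).symm
  have hle : j.succ ≤ j'.castSucc := by
    rw [Fin.le_def]; simpa using hlt
  have ht : t = G.node i j.succ :=
    le_antisymm hj.2 (((G.node_strictMono i).monotone hle).trans hj'.1)
  subst ht
  obtain ⟨r, hr⟩ := G.eq_add_of_node_mem i j _ hj
  obtain ⟨r', hr'⟩ := G.eq_add_of_node_mem i j' _ hj'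
  rw [G.iterate_derivative_basisPoly_eval_node k i j m _ ha hb r hr,
    G.iterate_derivative_basisPoly_eval_node k i j' m _ ha hb r' hr']

open Classical in
/-- The derivative of order `b` of the piecewise polynomial Hermite basis function of the axis `i`
that belongs to the grid point `m` and the order of differentiation `a`. -/
def axisBasis (k : ℕ) (i : Fin p) (m : Fin (G.numCells i + 1)) (a b : ℕ) (t : ℝ) : ℝ :=
  if h : ∃ j : Fin (G.numCells i), t ∈ Set.Icc (G.node i j.castSucc) (G.node i j.succ) then
    (Polynomial.derivative^[b] (G.basisPoly k i h.choose m a)).eval t else 0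

theorem axisBasis_eq (k : ℕ) (i : Fin p) (m : Fin (G.numCells i + 1)) {a b : ℕ}
    (ha : a ≤ k) (hb : b ≤ k) {t : ℝ} (j : Fin (G.numCells i))
    (hj : t ∈ Set.Icc (G.node i j.castSucc) (G.node i j.succ)) :
    G.axisBasis k i m a b t = (Polynomial.derivative^[b] (G.basisPoly k i j m a)).eval t := by
  have h : ∃ j : Fin (G.numCells i), t ∈ Set.Icc (G.node i j.castSucc) (G.node i j.succ) :=
    ⟨j, hj⟩
  rw [axisBasis, dif_pos h]
  exact G.basisPoly_eval_eq_of_mem k i m ha hb _ _ h.choose_spec hj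

theorem node_mem_Icc (i : Fin p) (l : Fin (G.numCells i + 1)) :
    G.node i l ∈ Set.Icc (G.lo i) (G.hi i) :=
  ⟨(G.node_strictMono i).monotone (Fin.zero_le _), (G.node_strictMono i).monotone (Fin.le_last _)⟩

theorem axisBasis_node (k : ℕ) (i : Fin p) (m l : Fin (G.numCells i + 1)) {a b : ℕ}
    (ha : a ≤ k) (hb : b ≤ k) :
    G.axisBasis k i m a b (G.node i l) = if m = l ∧ a = b then 1 else 0 := by
  obtain ⟨j, hj⟩ := G.exists_axisCell i (G.node_mem_Icc i l)
  obtain ⟨r, hr⟩ := G.eq_add_of_node_mem i j _ hj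
  rw [G.axisBasis_eq k i m ha hb j hj,
    G.iterate_derivative_basisPoly_eval_node k i j m l ha hb r hr]

/-- The derivative within each closed cell is the same number, so it is the derivative within their
finite union. The bound `b < k` is needed because the pieces are matched only up to order `k`, and
`b + 1` must still be such an order. -/
theorem hasDerivWithinAt_axisBasis (k : ℕ) (i : Fin p) (m : Fin (G.numCells i + 1)) {a b : ℕ}
    (ha : a ≤ k) (hb : b < k) {t : ℝ} :
    HasDerivWithinAt (G.axisBasis k i m a b) (G.axisBasis k i m a (b + 1) t)
      (Set.Icc (G.lo i) (G.hi i)) t := by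
  have hcell : ∀ j : Fin (G.numCells i),
      HasDerivWithinAt (G.axisBasis k i m a b) (G.axisBasis k i m a (b + 1) t)
        (Set.Icc (G.node i j.castSucc) (G.node i j.succ)) t := by
    intro j
    by_cases hj : t ∈ Set.Icc (G.node i j.castSucc) (G.node i j.succ)
    · rw [G.axisBasis_eq k i m ha hb j hj, Function.iterate_succ_apply']
      exact (Polynomial.hasDerivAt _ t).hasDerivWithinAt.congr
        (fun s hs => G.axisBasis_eq k i m ha hb.le j hs) (G.axisBasis_eq k i m ha hb.le j hj)
    -- Away from a closed cell, any number is a derivative within it.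
    · exact HasFDerivWithinAt.of_notMem_closure (by rwa [isClosed_Icc.closure_eq])
  have hfin : ∀ s : Finset (Fin (G.numCells i)),
      HasDerivWithinAt (G.axisBasis k i m a b) (G.axisBasis k i m a (b + 1) t)
        (⋃ j ∈ s, Set.Icc (G.node i j.castSucc) (G.node i j.succ)) t := by
    intro s
    induction s using Finset.induction_on with
    | empty => exact HasFDerivWithinAt.of_notMem_closure (by simp)
    | insert j s _ ih =>
      rw [Finset.set_biUnion_insert]
      exact (hcell j).union ih
  refine (hfin Finset.univ).mono fun s hs => ?_
  obtain ⟨j, hj⟩ := G.exists_axisCell i hs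
  exact Set.mem_biUnion (Finset.mem_coe.2 (Finset.mem_univ j)) hj

variable {k : ℕ}

/-- Summing over all grid points instead of the vertices of `c` makes the index set and the
coefficients independent of the cell. The added terms vanish because some factor `basisPoly` is
zero. -/
theorem cellInterpolant_eq_sum (d : G.Data k) (c : G.Cell) (x : Fin p → ℝ) :
    G.cellInterpolant k d c x = ∑ l : G.Index × (Fin p → Fin (k + 1)), d l.1 l.2 *
      ∏ i, (G.basisPoly k i (c i) (l.1 i) (l.2 i)).eval (x i) := by
  have h1 : ∀ (m : G.Index) (α : Fin p → Fin (k + 1)),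
      ∏ i, (G.basisPoly k i (c i) (m i) (α i)).eval (x i) =
      ∑ q : Fin p → Fin 2, if m = G.vertex c q then
        ∏ i, (G.cellHi c i - G.cellLo c i) ^ (α i : ℕ) * (hermiteBasis k (α i) (q i)).eval
          ((x i - G.cellLo c i) / (G.cellHi c i - G.cellLo c i)) else 0 := by
    intro m α
    simp only [basisPoly, Polynomial.eval_finsetSum]
    rw [Finset.prod_univ_sum, Fintype.piFinset_univ]
    refine Finset.sum_congr rfl fun q _ => ?_
    have h2 : ∀ i, (if (m i : ℕ) = (c i : ℕ) + (q i : ℕ) then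
        Polynomial.C ((G.node i (c i).succ - G.node i (c i).castSucc) ^ (α i : ℕ)) *
        (hermiteBasis k (α i) (q i)).comp
        (Polynomial.C (G.node i (c i).succ - G.node i (c i).castSucc)⁻¹ *
        (Polynomial.X - Polynomial.C (G.node i (c i).castSucc))) else 0).eval (x i) =
        if (m i : ℕ) = (c i : ℕ) + (q i : ℕ) then
        (G.cellHi c i - G.cellLo c i) ^ (α i : ℕ) * (hermiteBasis k (α i) (q i)).eval
          ((x i - G.cellLo c i) / (G.cellHi c i - G.cellLo c i)) else 0 := by
      intro i
      split_ifs
      · simp [Polynomial.eval_comp, cellHi, cellLo, div_eq_inv_mul]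
      · simp
    rw [Finset.prod_congr rfl fun i _ => h2 i]
    by_cases hm : m = G.vertex c q
    · rw [if_pos hm, hm]
      exact Finset.prod_congr rfl fun i _ => if_pos rfl
    · obtain ⟨i, hi⟩ := Function.ne_iff.1 hm
      rw [if_neg hm]
      exact Finset.prod_eq_zero (Finset.mem_univ i) (if_neg fun h => hi (Fin.ext h))
  rw [cellInterpolant, Fintype.sum_prod_type, Finset.sum_comm]
  conv_rhs => rw [Finset.sum_comm]
  refine Finset.sum_congr rfl fun α _ => ?_
  simp only [h1, Finset.mul_sum]
  rw [Finset.sum_comm]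
  refine Finset.sum_congr rfl fun q _ => ?_
  simp

theorem mem_closedCell_iff {c : G.Cell} {x : Fin p → ℝ} : x ∈ G.closedCell c ↔
    ∀ i, x i ∈ Set.Icc (G.node i (c i).castSucc) (G.node i (c i).succ) := by
  simp only [closedCell, cellLo, cellHi, Set.mem_univ_pi]

theorem exists_mem_closedCell {x : Fin p → ℝ} (hx : x ∈ G.domain) :
    ∃ c : G.Cell, x ∈ G.closedCell c := by
  choose c hc using fun i => G.exists_axisCell i (hx i trivial)
  exact ⟨c, G.mem_closedCell_iff.2 hc⟩

theorem closedCell_subset_domain (c : G.Cell) : G.closedCell c ⊆ G.domain := fun _ hx i hi =>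
  ⟨(G.lo_le_cellLo c i).trans (hx i hi).1, (hx i hi).2.trans (G.cellHi_le_hi c i)⟩

theorem openCell_subset_closedCell (c : G.Cell) : G.openCell c ⊆ G.closedCell c :=
  Set.pi_mono fun _ _ => Set.Ioo_subset_Icc_self

/-- The cells chosen in `interpolant` and in `axisBasis` may differ on common boundaries;
`axisBasis_eq` shows that this does not affect the values. -/
theorem interpolant_eq_sum_axisBasis (d : G.Data k) :
    Set.EqOn (G.interpolant k d) (fun x => ∑ l : G.Index × (Fin p → Fin (k + 1)), d l.1 l.2 *
      ∏ i, G.axisBasis k i (l.1 i) (l.2 i) 0 (x i)) G.domain := by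
  intro x hx
  have h := G.exists_mem_closedCell hx
  rw [interpolant, dif_pos h, cellInterpolant_eq_sum]
  refine Finset.sum_congr rfl fun l _ => ?_
  congr 1
  refine Finset.prod_congr rfl fun i _ => ?_
  rw [G.axisBasis_eq k i _ (Nat.lt_succ_iff.1 (l.2 i).isLt) (Nat.zero_le k) _
    (G.mem_closedCell_iff.1 h.choose_spec i)]
  rfl

/-- The mixed derivative of order `γ` of the polynomial that the interpolant is in the cell `c`. -/
def cellDeriv (d : G.Data k) (c : G.Cell) (γ : Fin p → ℕ) (x : Fin p → ℝ) : ℝ :=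
  ∑ l : G.Index × (Fin p → Fin (k + 1)), d l.1 l.2 *
    ∏ i, (Polynomial.derivative^[γ i] (G.basisPoly k i (c i) (l.1 i) (l.2 i))).eval (x i)

theorem contDiff_cellDeriv (d : G.Data k) (c : G.Cell) (γ : Fin p → ℕ) (n : WithTop ℕ∞) :
    ContDiff ℝ n (G.cellDeriv d c γ) := by
  refine ContDiff.sum fun l _ => contDiff_const.mul (contDiff_prod fun i _ => ?_)
  simpa only [Polynomial.coe_aeval_eq_eval, Function.comp_def] using
    (Polynomial.contDiff_aeval (Polynomial.derivative^[γ i]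
      (G.basisPoly k i (c i) (l.1 i) (l.2 i))) n).comp (contDiff_apply ℝ ℝ i)

theorem interpolant_eqOn_openCell (d : G.Data k) (c : G.Cell) :
    Set.EqOn (G.interpolant k d) (G.cellDeriv d c 0) (G.openCell c) := by
  intro x hx
  have hx' := G.openCell_subset_closedCell c hx
  rw [G.interpolant_eq_sum_axisBasis d (G.closedCell_subset_domain c hx')]
  refine Finset.sum_congr rfl fun l _ => ?_
  congr 1
  refine Finset.prod_congr rfl fun i _ => ?_
  rw [G.axisBasis_eq k i _ (Nat.lt_succ_iff.1 (l.2 i).isLt) (Nat.zero_le k) _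
    (G.mem_closedCell_iff.1 hx' i)]
  rfl

theorem mixedDeriv_interpolant_eqOn_openCell (d : G.Data k) (c : G.Cell) (γ : Fin p → ℕ) :
    Set.EqOn (G.mixedDeriv γ (G.interpolant k d)) (G.cellDeriv d c γ) (G.openCell c) := by
  refine (G.isLocalBox_openCell c).eqOn_mixedDeriv_tensor (fun l : G.Index × (Fin p → Fin (k + 1)) => d l.1 l.2)
    (fun l i b t => (Polynomial.derivative^[b]
      (G.basisPoly k i (c i) (l.1 i) (l.2 i))).eval t) γ (fun l i b _ t _ => ?_)
    (G.interpolant_eqOn_openCell d c)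
  rw [Function.iterate_succ_apply']
  exact (Polynomial.hasDerivAt _ t).hasDerivWithinAt

theorem sum_mul_prod_ite (d : G.Data k) (m : G.Index) (α : Fin p → Fin (k + 1)) :
    ∑ l : G.Index × (Fin p → Fin (k + 1)), d l.1 l.2 *
      ∏ i, (if l.1 i = m i ∧ ((l.2 i : ℕ) = (α i : ℕ)) then (1 : ℝ) else 0) = d m α := by
  rw [Finset.sum_eq_single (m, α)]
  · simp
  · intro l _ hl
    rw [Finset.prod_ite_zero, if_neg, mul_zero]
    intro h
    refine hl (Prod.ext (funext fun i => (h i (Finset.mem_univ i)).1) (funext fun i => ?_))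
    exact Fin.ext (h i (Finset.mem_univ i)).2
  · simp

theorem cellDeriv_vertex (d : G.Data k) (c : G.Cell) (q : Fin p → Fin 2)
    (α : Fin p → Fin (k + 1)) :
    G.cellDeriv d c (fun i => (α i : ℕ)) (G.point (G.vertex c q)) = d (G.vertex c q) α := by
  rw [← G.sum_mul_prod_ite d (G.vertex c q) α]
  refine Finset.sum_congr rfl fun l _ => ?_
  congr 1
  refine Finset.prod_congr rfl fun i _ => ?_
  exact G.iterate_derivative_basisPoly_eval_node k i (c i) (l.1 i) _
    (Nat.lt_succ_iff.1 (l.2 i).isLt) (Nat.lt_succ_iff.1 (α i).isLt) (q i) rfl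

/-- Derivatives at a grid point are taken within `Ω`, across all adjoining cells, so the formula of
a single cell does not suffice. The tensor product form on all of `Ω` is differentiated instead,
with `C^k` factors. -/
theorem gridData_interpolant (d : G.Data k) : G.gridData k (G.interpolant k d) = d := by
  funext m α
  have hm : G.point m ∈ G.domain := fun i _ => G.node_mem_Icc i (m i)
  have hα : ∀ i, (α i : ℕ) ≤ k := fun i => Nat.lt_succ_iff.1 (α i).isLt
  rw [gridData, G.isLocalBox_domain.eqOn_mixedDeriv_tensor (fun l : G.Index × (Fin p → Fin (k + 1)) => d l.1 l.2)
    (fun l i b t => G.axisBasis k i (l.1 i) (l.2 i) b t) (fun i => (α i : ℕ))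
    (fun l i b hb t _ => G.hasDerivWithinAt_axisBasis k i _ (Nat.lt_succ_iff.1 (l.2 i).isLt)
      (hb.trans_le (hα i)))
    (G.interpolant_eq_sum_axisBasis d) hm, ← G.sum_mul_prod_ite d m α]
  refine Finset.sum_congr rfl fun l _ => ?_
  congr 1
  exact Finset.prod_congr rfl fun i _ =>
    G.axisBasis_node k i _ _ (Nat.lt_succ_iff.1 (l.2 i).isLt) (hα i)

theorem cellwiseSmooth_interpolant (d : G.Data k) (n : WithTop ℕ∞) :
    G.CellwiseSmooth n (G.interpolant k d) := fun c =>
  (G.contDiff_cellDeriv d c 0 n).contDiffOn.congr (G.interpolant_eqOn_openCell d c)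

theorem matchesData_interpolant (d : G.Data k) : G.MatchesData k d (G.interpolant k d) := by
  intro c q α
  rw [← G.cellDeriv_vertex d c q α]
  refine Filter.Tendsto.congr' ?_
    ((G.contDiff_cellDeriv d c _ 0).continuous.continuousWithinAt (s := G.openCell c)).tendsto
  filter_upwards [self_mem_nhdsWithin] with x hx
  exact (G.mixedDeriv_interpolant_eqOn_openCell d c _ hx).symm

end RectGrid
end

/-! ### Orthogonality in a cell and minimality -/

noncomputable section

open MeasureTheory Filter

theorem continuous_boundaryCoeff (k : ℕ) (P : ℝ[X]) (e : Fin 2 × Fin (k + 1)) :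
    Continuous fun z : ℝ × ℝ => boundaryCoeff k P z.1 z.2 e := by
  unfold boundaryCoeff
  split_ifs
  · exact continuous_const.mul ((Polynomial.continuous _).comp continuous_fst)
  · exact continuous_const.mul ((Polynomial.continuous _).comp continuous_snd)

namespace RectGrid
variable {p k : ℕ} (G : RectGrid p)

theorem closedCell_eq_Icc (c : G.Cell) : G.closedCell c = Set.Icc (G.cellLo c) (G.cellHi c) :=
  Set.pi_univ_Icc _ _

theorem isCompact_closedCell (c : G.Cell) : IsCompact (G.closedCell c) := by
  rw [closedCell_eq_Icc]; exact isCompact_Icc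

theorem measurableSet_closedCell (c : G.Cell) : MeasurableSet (G.closedCell c) :=
  (G.isCompact_closedCell c).measurableSet

theorem openCell_ae_eq_closedCell (c : G.Cell) : G.openCell c =ᵐ[volume] G.closedCell c := by
  rw [closedCell_eq_Icc]; exact Measure.univ_pi_Ioo_ae_eq_Icc

/-- The boundary of a cell is a null set, so the values of `∂^β` there, where the derivative may
fail to exist, play no role in the integrals. -/
theorem ae_restrict_closedCell_of_forall {c : G.Cell} {q : (Fin p → ℝ) → Prop}
    (h : ∀ x ∈ G.openCell c, q x) : ∀ᵐ x ∂volume.restrict (G.closedCell c), q x := by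
  rw [← Measure.restrict_congr_set (G.openCell_ae_eq_closedCell c)]
  exact ae_restrict_of_forall_mem (G.isOpen_openCell c).measurableSet h

theorem sum_beta : ∑ i, beta p k i = p * (k + 1) := by simp [beta]

theorem hasDerivAt_mixedDeriv {c : G.Cell} {u : (Fin p → ℝ) → ℝ} {N : ℕ}
    (hu : ContDiffOn ℝ (N : WithTop ℕ∞) u (G.openCell c)) (γ : Fin p → ℕ)
    (hγ : ∑ i, γ i + 1 ≤ N) (i : Fin p) {x : Fin p → ℝ} (hx : x ∈ G.openCell c) :
    HasDerivAt (fun s => G.mixedDeriv γ u (Function.update x i s))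
      (G.mixedDeriv (Function.update γ i (γ i + 1)) u x) (x i) := by
  have hu' := hu.of_le (m := ((∑ i, γ i + 1 : ℕ) : WithTop ℕ∞)) (by exact_mod_cast hγ)
  have hd := G.differentiableAt_of_contDiffOn one_pos
    (G.contDiffOn_openCell_mixedDeriv γ 1 (by rwa [add_comm])) hx
  rw [← G.pderiv_mixedDeriv i γ hu' hx, G.pderiv_eq_fderiv hx hd i]
  exact hasDerivAt_update_of_differentiableAt hd i

/-- Each side is shortened at both ends by a proportion `δ n` tending to `0`. This gives compact
boxes on which functions smooth in the open cell can be integrated by parts. -/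
theorem exists_box_exhaustion (c : G.Cell) : ∃ a b : ℕ → Fin p → ℝ,
    (∀ n, a n ≤ b n) ∧ Monotone (fun n => Set.Icc (a n) (b n)) ∧
    ⋃ n, Set.Icc (a n) (b n) = G.openCell c ∧
    (∀ i, Tendsto (fun n => a n i) atTop (𝓝 (G.cellLo c i))) ∧
    ∀ i, Tendsto (fun n => b n i) atTop (𝓝 (G.cellHi c i)) := by
  -- The shift by `3` keeps `δ n ≤ 1/3 < 1/2`, so the boxes are nonempty from `n = 0` on.
  set δ : ℕ → ℝ := fun n => 1 / ((n : ℝ) + 3) with hδ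
  have hδpos : ∀ n, 0 < δ n := fun n => by positivity
  have hδle : ∀ n, δ n ≤ 1 / 3 := fun n =>
    one_div_le_one_div_of_le (by norm_num) (by have := Nat.cast_nonneg (α := ℝ) n; linarith)
  have hδanti : Antitone δ := fun m n hmn =>
    one_div_le_one_div_of_le (by positivity) (by have := Nat.cast_le (α := ℝ).2 hmn; linarith)
  have hδ0 : Tendsto δ atTop (𝓝 0) := by
    simp only [hδ, one_div]
    exact tendsto_inv_atTop_zero.comp
      (tendsto_atTop_add_const_right _ _ tendsto_natCast_atTop_atTop)
  have hlt : ∀ i, 0 < G.cellHi c i - G.cellLo c i := fun i => sub_pos.2 (G.cellLo_lt_cellHi c i)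
  have ha : ∀ i, Tendsto (fun n => G.cellLo c i + δ n * (G.cellHi c i - G.cellLo c i)) atTop
      (𝓝 (G.cellLo c i)) := fun i => by
    simpa using (hδ0.mul_const (G.cellHi c i - G.cellLo c i)).const_add (G.cellLo c i)
  have hb : ∀ i, Tendsto (fun n => G.cellHi c i - δ n * (G.cellHi c i - G.cellLo c i)) atTop
      (𝓝 (G.cellHi c i)) := fun i => by
    simpa using (hδ0.mul_const (G.cellHi c i - G.cellLo c i)).const_sub (G.cellHi c i)
  refine ⟨fun n i => G.cellLo c i + δ n * (G.cellHi c i - G.cellLo c i),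
    fun n i => G.cellHi c i - δ n * (G.cellHi c i - G.cellLo c i), ?_, ?_, ?_, ha, hb⟩
  · intro n i
    have := mul_le_mul_of_nonneg_right (hδle n) (hlt i).le
    simp only
    linarith [hlt i]
  · intro m n hmn
    refine Set.Icc_subset_Icc (fun i => ?_) (fun i => ?_) <;>
    · have := mul_le_mul_of_nonneg_right (hδanti hmn) (hlt i).le
      simp only
      linarith
  · ext x
    simp only [Set.mem_iUnion]
    constructor
    · rintro ⟨n, h1, h2⟩ i _
      have := mul_pos (hδpos n) (hlt i)
      have h1 := h1 i
      have h2 := h2 i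
      simp only at h1 h2
      exact ⟨by linarith, by linarith⟩
    · intro hx
      have h1 := eventually_all.2 fun i => (ha i).eventually (gt_mem_nhds (hx i trivial).1)
      have h2 := eventually_all.2 fun i => (hb i).eventually (lt_mem_nhds (hx i trivial).2)
      obtain ⟨n, hn1, hn2⟩ := (h1.and h2).exists
      exact ⟨n, fun i => (hn1 i).le, fun i => (hn2 i).le⟩

theorem point_vertex_apply (c : G.Cell) (q : Fin p → Fin 2) (i : Fin p) :
    G.point (G.vertex c q) i = if q i = 0 then G.cellLo c i else G.cellHi c i := by
  have hq : q i = 0 ∨ q i = 1 := by omega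
  rcases hq with h | h <;> simp only [point, vertex, cellLo, cellHi, h] <;> rfl

/-- If the derivatives of `u` of order at most `k` in each variable vanish at the vertices of a
cell, then `∂^β u` is orthogonal to the products of univariate polynomials of degree at most `k`. -/
theorem integral_prod_eval_mul_mixedDeriv_eq_zero {c : G.Cell} {u : (Fin p → ℝ) → ℝ}
    (hu : ContDiffOn ℝ ((p * (k + 1) : ℕ) : WithTop ℕ∞) u (G.openCell c))
    (hu0 : ∀ (q : Fin p → Fin 2) (α : Fin p → Fin (k + 1)),
      Tendsto (G.mixedDeriv (fun i => (α i : ℕ)) u)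
        (𝓝[G.openCell c] G.point (G.vertex c q)) (𝓝 0))
    {P : Fin p → ℝ[X]} (hP : ∀ i, Polynomial.derivative^[k + 1] (P i) = 0)
    (hi : IntegrableOn (fun x => (∏ i, (P i).eval (x i)) * G.mixedDeriv (beta p k) u x)
      (G.openCell c)) :
    ∫ x in G.openCell c, (∏ i, (P i).eval (x i)) * G.mixedDeriv (beta p k) u x = 0 := by
  obtain ⟨a, b, hab, hmono, hunion, ha, hb⟩ := G.exists_box_exhaustion c
  have hsub : ∀ n, Set.Icc (a n) (b n) ⊆ G.openCell c := fun n => by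
    rw [← hunion]; exact Set.subset_iUnion (fun n => Set.Icc (a n) (b n)) n
  have hsum : ∀ γ : Fin p → ℕ, (∀ i, γ i ≤ k + 1) → ∑ i, γ i ≤ p * (k + 1) := fun γ hγ => by
    rw [← sum_beta]; exact Finset.sum_le_sum fun i _ => hγ i
  have hbox : ∀ n, ∫ x in Set.Icc (a n) (b n),
      (∏ i, (P i).eval (x i)) * G.mixedDeriv (beta p k) u x = _ := fun n =>
    integral_prod_eval_mul_eq_sum k (a n) (b n) (hab n) P hP (fun γ => G.mixedDeriv γ u)
      (fun γ hγ => ((G.contDiffOn_openCell_mixedDeriv γ 0 (hu.of_le (by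
        rw [zero_add]; exact_mod_cast hsum γ hγ))).continuousOn).mono (hsub n))
      -- One more derivative is available because `γ i ≤ k` makes the total order of `γ` strictly
      -- less than `p(k+1)`.
      (fun γ hγ i hγi x hx => G.hasDerivAt_mixedDeriv hu γ (by
        rw [← sum_beta]
        exact Finset.sum_lt_sum (fun i _ => hγ i) ⟨i, Finset.mem_univ i, Nat.lt_succ_of_le hγi⟩)
        i (hsub n hx))
  have hlim := tendsto_setIntegral_of_monotone (fun n => measurableSet_Icc) hmono
    (hunion.symm ▸ hi)
  rw [hunion] at hlim
  refine tendsto_nhds_unique hlim ?_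
  simp only [hbox]
  rw [show (0 : ℝ) = ∑ _e : Fin p → Fin 2 × Fin (k + 1), 0 by simp]
  refine tendsto_finsetSum _ fun e _ => ?_
  have hcoef : Tendsto (fun n => ∏ i, boundaryCoeff k (P i) (a n i) (b n i) (e i)) atTop
      (𝓝 (∏ i, boundaryCoeff k (P i) (G.cellLo c i) (G.cellHi c i) (e i))) :=
    tendsto_finsetProd _ fun i _ =>
      ((continuous_boundaryCoeff k (P i) (e i)).tendsto (G.cellLo c i, G.cellHi c i)).comp
        ((ha i).prodMk_nhds (hb i))
  -- The vertices of the boxes approach those of the cell from inside, so `hu0` applies to every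
  -- boundary term.
  have hv : Tendsto (fun n => (fun i => if (e i).1 = 0 then a n i else b n i : Fin p → ℝ)) atTop
      (𝓝[G.openCell c] G.point (G.vertex c fun i => (e i).1)) := by
    refine tendsto_nhdsWithin_iff.2 ⟨tendsto_pi_nhds.2 fun i => ?_, .of_forall fun n => ?_⟩
    · rw [point_vertex_apply]
      split_ifs
      exacts [ha i, hb i]
    · refine hsub n ⟨fun i => ?_, fun i => ?_⟩ <;> dsimp only <;> split_ifs
      exacts [le_rfl, hab n i, hab n i, le_rfl]
  simpa using hcoef.mul ((hu0 (fun i => (e i).1) (fun i => (e i).2)).comp hv)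

/-- `∂^β` of the interpolant is a sum of products of univariate polynomials of degree at most `k`,
and the difference has vanishing data at the vertices. Integrability of `∂^β ψ` suffices because the
polynomial factors are bounded on the cell. -/
theorem orthogonality (d : G.Data k) (c : G.Cell) {ψ : (Fin p → ℝ) → ℝ}
    (hψ : G.CellwiseSmooth ((p * (k + 1) : ℕ) : WithTop ℕ∞) ψ) (hψd : G.MatchesData k d ψ)
    (hi : IntegrableOn (G.mixedDeriv (beta p k) ψ) (G.closedCell c)) :
    IntegrableOn (fun x => G.mixedDeriv (beta p k) (G.interpolant k d) x *
        G.mixedDeriv (beta p k) (fun y => ψ y - G.interpolant k d y) x) (G.closedCell c) ∧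
      ∫ x in G.closedCell c, G.mixedDeriv (beta p k) (G.interpolant k d) x *
        G.mixedDeriv (beta p k) (fun y => ψ y - G.interpolant k d y) x = 0 := by
  set u : (Fin p → ℝ) → ℝ := fun y => ψ y - G.interpolant k d y
  have hH := G.cellwiseSmooth_interpolant d ((p * (k + 1) : ℕ) : WithTop ℕ∞)
  have hu : ContDiffOn ℝ ((p * (k + 1) : ℕ) : WithTop ℕ∞) u (G.openCell c) := (hψ c).sub (hH c)
  have hsub : ∀ γ : Fin p → ℕ, (∀ i, γ i ≤ k + 1) → Set.EqOn (G.mixedDeriv γ u)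
      (fun x => G.mixedDeriv γ ψ x - G.mixedDeriv γ (G.interpolant k d) x) (G.openCell c) := by
    intro γ hγ
    have hle : ((∑ i, γ i : ℕ) : WithTop ℕ∞) ≤ ((p * (k + 1) : ℕ) : WithTop ℕ∞) := by
      rw [← sum_beta]; exact_mod_cast Finset.sum_le_sum fun i _ => hγ i
    exact G.mixedDeriv_sub γ ((hψ c).of_le hle) ((hH c).of_le hle)
  have hu0 : ∀ (q : Fin p → Fin 2) (α : Fin p → Fin (k + 1)),
      Tendsto (G.mixedDeriv (fun i => (α i : ℕ)) u)
        (𝓝[G.openCell c] G.point (G.vertex c q)) (𝓝 0) := by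
    intro q α
    have h := (hψd c q α).sub (G.matchesData_interpolant d c q α)
    rw [sub_self] at h
    refine h.congr' ?_
    filter_upwards [self_mem_nhdsWithin] with x hx
    exact (hsub _ (fun i => (α i).isLt.le) hx).symm
  have hui : IntegrableOn (G.mixedDeriv (beta p k) u) (G.closedCell c) := by
    have h := hi.sub ((G.contDiff_cellDeriv d c (beta p k) 0).continuous.continuousOn
      |>.integrableOn_compact (G.isCompact_closedCell c))
    refine h.congr (G.ae_restrict_closedCell_of_forall fun x hx => ?_)
    rw [hsub (beta p k) (fun _ => le_rfl) hx]
    simp only [Pi.sub_apply, G.mixedDeriv_interpolant_eqOn_openCell d c _ hx]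
  set F : G.Index × (Fin p → Fin (k + 1)) → (Fin p → ℝ) → ℝ := fun l x => d l.1 l.2 *
    ((∏ i, (Polynomial.derivative^[k + 1]
      (G.basisPoly k i (c i) (l.1 i) (l.2 i))).eval (x i)) * G.mixedDeriv (beta p k) u x) with hF
  have hprod : ∀ l : G.Index × (Fin p → Fin (k + 1)), IntegrableOn (fun x =>
      (∏ i, (Polynomial.derivative^[k + 1]
        (G.basisPoly k i (c i) (l.1 i) (l.2 i))).eval (x i)) * G.mixedDeriv (beta p k) u x)
      (G.closedCell c) := fun l =>
    hui.continuousOn_mul (continuous_finsetProd _ fun i _ =>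
      (Polynomial.continuous _).comp (continuous_apply i)).continuousOn (G.isCompact_closedCell c)
  have hFi : ∀ l, IntegrableOn (F l) (G.closedCell c) := fun l => (hprod l).const_mul _
  have heq : ∀ᵐ x ∂volume.restrict (G.closedCell c), ∑ l, F l x =
      G.mixedDeriv (beta p k) (G.interpolant k d) x * G.mixedDeriv (beta p k) u x := by
    refine G.ae_restrict_closedCell_of_forall fun x hx => ?_
    rw [G.mixedDeriv_interpolant_eqOn_openCell d c _ hx, cellDeriv, Finset.sum_mul]
    exact Finset.sum_congr rfl fun l _ => (mul_assoc _ _ _).symm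
  refine ⟨(integrable_finsetSum _ fun l _ => hFi l).congr heq, ?_⟩
  rw [← integral_congr_ae heq, integral_finsetSum _ fun l _ => hFi l]
  refine Finset.sum_eq_zero fun l _ => ?_
  rw [hF]
  simp only
  rw [integral_const_mul, ← setIntegral_congr_set (G.openCell_ae_eq_closedCell c),
    G.integral_prod_eval_mul_mixedDeriv_eq_zero hu hu0 (fun i => ?_)
      ((hprod l).mono_set (G.openCell_subset_closedCell c)), mul_zero]
  -- The factors are already differentiated `k + 1` times; another `k + 1` make `2k + 2` derivatives
  -- of a polynomial of degree at most `2k + 1`.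
  rw [← Function.iterate_add_apply]
  refine Polynomial.iterate_derivative_eq_zero ?_
  have := G.basisPoly_natDegree_le k i (c i) (l.1 i) (Nat.lt_succ_iff.1 (l.2 i).isLt)
  omega

theorem mixedDeriv_beta_interpolant_ae (d : G.Data k) (c : G.Cell) :
    G.mixedDeriv (beta p k) (G.interpolant k d) =ᵐ[volume.restrict (G.closedCell c)]
      G.cellDeriv d c (beta p k) :=
  G.ae_restrict_closedCell_of_forall fun _ hx => G.mixedDeriv_interpolant_eqOn_openCell d c _ hx

theorem integrableOn_sq_mixedDeriv_interpolant (d : G.Data k) (c : G.Cell) :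
    IntegrableOn (fun x => G.mixedDeriv (beta p k) (G.interpolant k d) x ^ 2)
      (G.closedCell c) := by
  refine (((G.contDiff_cellDeriv d c (beta p k) 0).continuous.pow 2).continuousOn
    |>.integrableOn_compact (G.isCompact_closedCell c)).congr ?_
  filter_upwards [G.mixedDeriv_beta_interpolant_ae d c] with x hx
  rw [hx]; rfl

/-- The interpolant minimizes the stability functional of a single cell. -/
theorem lintegral_closedCell_interpolant_le (d : G.Data k) (c : G.Cell) {ψ : (Fin p → ℝ) → ℝ}
    (hψ : G.CellwiseSmooth ((p * (k + 1) : ℕ) : WithTop ℕ∞) ψ) (hψd : G.MatchesData k d ψ) :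
    ∫⁻ x in G.closedCell c,
        ENNReal.ofReal (G.mixedDeriv (beta p k) (G.interpolant k d) x ^ 2) ≤
      ∫⁻ x in G.closedCell c, ENNReal.ofReal (G.mixedDeriv (beta p k) ψ x ^ 2) := by
  by_cases htop : ∫⁻ x in G.closedCell c, ENNReal.ofReal (G.mixedDeriv (beta p k) ψ x ^ 2) = ⊤
  · rw [htop]; exact le_top
  have hsum : ((∑ i, beta p k i : ℕ) : WithTop ℕ∞) ≤ ((p * (k + 1) : ℕ) : WithTop ℕ∞) := by
    rw [sum_beta]
  have hmeas : AEStronglyMeasurable (G.mixedDeriv (beta p k) ψ)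
      (volume.restrict (G.closedCell c)) := by
    rw [← Measure.restrict_congr_set (G.openCell_ae_eq_closedCell c)]
    exact (G.contDiffOn_openCell_mixedDeriv (beta p k) 0 ((hψ c).of_le
      (by rwa [zero_add]))).continuousOn.aestronglyMeasurable
      (G.isOpen_openCell c).measurableSet
  have hsq : IntegrableOn (fun x => G.mixedDeriv (beta p k) ψ x ^ 2) (G.closedCell c) :=
    ⟨hmeas.pow 2, (hasFiniteIntegral_iff_ofReal (ae_of_all _ fun x => sq_nonneg _)).2
      (lt_top_iff_ne_top.2 htop)⟩
  have : IsFiniteMeasure (volume.restrict (G.closedCell c)) :=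
    ⟨by simpa using (G.isCompact_closedCell c).measure_lt_top⟩
  -- Finite energy gives square integrability, hence integrability on a cell of finite volume, as
  -- `orthogonality` requires.
  have hint : IntegrableOn (G.mixedDeriv (beta p k) ψ) (G.closedCell c) :=
    ((memLp_two_iff_integrable_sq hmeas).2 hsq).integrable one_le_two
  obtain ⟨hoi, ho⟩ := G.orthogonality d c hψ hψd hint
  have hH := G.integrableOn_sq_mixedDeriv_interpolant d c
  rw [← ofReal_integral_eq_lintegral_ofReal hH (ae_of_all _ fun x => sq_nonneg _),
    ← ofReal_integral_eq_lintegral_ofReal hsq (ae_of_all _ fun x => sq_nonneg _)]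
  refine ENNReal.ofReal_le_ofReal ?_
  -- With `h = ∂^β H` and `v = ∂^β (ψ - H)`, orthogonality gives `∫ h^2 = ∫ (h^2 + 2hv)`, and
  -- pointwise `h^2 + 2hv ≤ (h + v)^2`. Thus integrability of `v^2` is not needed.
  have h1 := integral_add hH (hoi.const_mul 2)
  rw [integral_const_mul, ho, mul_zero, add_zero] at h1
  rw [← h1]
  refine integral_mono_ae (hH.add (hoi.const_mul 2)) hsq
    (G.ae_restrict_closedCell_of_forall fun x hx => ?_)
  simp only
  rw [G.mixedDeriv_sub (beta p k) ((hψ c).of_le hsum)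
    (G.cellwiseSmooth_interpolant d _ c) hx]
  nlinarith [sq_nonneg (G.mixedDeriv (beta p k) ψ x -
    G.mixedDeriv (beta p k) (G.interpolant k d) x)]

theorem disjoint_openCell {c c' : G.Cell} (h : c ≠ c') :
    Disjoint (G.openCell c) (G.openCell c') := by
  obtain ⟨i, hi⟩ := Function.ne_iff.1 h
  refine Set.disjoint_left.2 fun x hx hx' => ?_
  have key : ∀ c c' : G.Cell, c i < c' i → x ∈ G.openCell c → x ∈ G.openCell c' → False := by
    intro c c' hlt hx hx'
    have hle : (c i).succ ≤ (c' i).castSucc := by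
      rw [Fin.le_def]; simpa using hlt
    exact absurd (((hx i trivial).2.trans_le ((G.node_strictMono i).monotone hle)).trans
      (hx' i trivial).1) (lt_irrefl _)
  rcases lt_or_gt_of_ne hi with hlt | hlt
  exacts [key c c' hlt hx hx', key c' c hlt hx' hx]

theorem stability_eq_sum (ψ : (Fin p → ℝ) → ℝ) : G.stability k ψ =
    ∑ c : G.Cell, ∫⁻ x in G.closedCell c,
      ENNReal.ofReal (G.mixedDeriv (beta p k) ψ x ^ 2) := by
  have hdom : G.domain = ⋃ c : G.Cell, G.closedCell c := by
    refine Set.Subset.antisymm (fun x hx => Set.mem_iUnion.2 (G.exists_mem_closedCell hx))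
      (Set.iUnion_subset G.closedCell_subset_domain)
  rw [stability, hdom, lintegral_iUnion₀
    (fun c => (G.measurableSet_closedCell c).nullMeasurableSet), tsum_fintype]
  intro c c' hcc
  exact (G.disjoint_openCell hcc).aedisjoint.congr (G.openCell_ae_eq_closedCell c).symm
    (G.openCell_ae_eq_closedCell c').symm

theorem stability_interpolant_lt_top (d : G.Data k) :
    G.stability k (G.interpolant k d) < ⊤ := by
  rw [stability_eq_sum]
  exact ENNReal.sum_lt_top.2 fun c _ =>
    (G.integrableOn_sq_mixedDeriv_interpolant d c).lintegral_lt_top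

theorem stability_interpolant_le (d : G.Data k) {ψ : (Fin p → ℝ) → ℝ}
    (hψ : G.CellwiseSmooth ((p * (k + 1) : ℕ) : WithTop ℕ∞) ψ) (hψd : G.MatchesData k d ψ) :
    G.stability k (G.interpolant k d) ≤ G.stability k ψ := by
  rw [stability_eq_sum, stability_eq_sum]
  exact Finset.sum_le_sum fun c _ => G.lintegral_closedCell_interpolant_le d c hψ hψd

end RectGrid

end

theorem mainTheorem3 (p k : ℕ) (G : RectGrid p) (φ : (Fin p → ℝ) → ℝ)
    (hφ : G.CellwiseSmooth ((p * (k + 1) : ℕ) : WithTop ℕ∞) φ)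
    (hφd : G.MatchesData k (G.gridData k φ) φ) :
    -- the Hermite interpolant is smooth in each cell and satisfies the constraints
    (G.CellwiseSmooth ∞ (G.hermite k φ) ∧
      G.MatchesData k (G.gridData k φ) (G.hermite k φ) ∧
      G.gridData k (G.hermite k φ) = G.gridData k φ ∧
      G.stability k (G.hermite k φ) < ⊤) ∧
    -- it does not increase the stability functional
    G.stability k (G.hermite k φ) ≤ G.stability k φ ∧
    -- it is a minimizer among the cellwise smooth functions with the same data
    (∀ ψ : (Fin p → ℝ) → ℝ, G.CellwiseSmooth ((p * (k + 1) : ℕ) : WithTop ℕ∞) ψ →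
      G.MatchesData k (G.gridData k φ) ψ →
      G.stability k (G.hermite k φ) ≤ G.stability k ψ) ∧
    -- orthogonality in each cell
    (∀ c : G.Cell,
      MeasureTheory.IntegrableOn (G.mixedDeriv (RectGrid.beta p k) φ) (G.closedCell c) →
      MeasureTheory.IntegrableOn (fun x => G.mixedDeriv (RectGrid.beta p k) (G.hermite k φ) x *
          G.mixedDeriv (RectGrid.beta p k) (fun y => φ y - G.hermite k φ y) x)
        (G.closedCell c) ∧
      ∫ x in G.closedCell c, G.mixedDeriv (RectGrid.beta p k) (G.hermite k φ) x *
          G.mixedDeriv (RectGrid.beta p k) (fun y => φ y - G.hermite k φ y) x = 0) := by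
  exact ⟨⟨G.cellwiseSmooth_interpolant _ _, G.matchesData_interpolant _, G.gridData_interpolant _,
    G.stability_interpolant_lt_top _⟩, G.stability_interpolant_le _ hφ hφd,
    fun ψ hψ hψd => G.stability_interpolant_le _ hψ hψd,
    fun c hi => G.orthogonality _ c hφ hφd hi⟩
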